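/- **Theorem 2.5.** Let $W$ be a positive real random variable with $\mathbb E[W^4]<\infty$ and $\mathbb E[W^2]<\mathbb E[W]$. For $n\in\mathbb N$ let $W_1,\dots,W_n$ be i.i.d. copies of $W$, let $L_n=\sum_{i=1}^n W_i$, and consider the generalised random graph on the vertex set $\{1,\dots,n\}$: conditionally on $W_1,\dots,W_n$, any two distinct vertices $i,j$ are joined by an edge, independently for distinct pairs, with probability $$\frac{W_iW_j}{W_iW_j+L_n}.$$ Let $\mathcal C_{\min}^{(n)}$ and $\mathcal C_{\max}^{(n)}$ be the lengths of the shortest and of the longest cycle of this graph, both set to $0$ if it has no cycle. Put $$\lambda_k=\frac1{2k}\left(\frac{\mathbb E[W^2]}{\mathbb E[W]}\right)^k\qquad(k\ge 3),$$ and let $\mathcal S$ and $\mathcal L$ be $\{0,3,4,\dots\}$-valued random variables whose distributions are given by $$\mathbb P(\mathcal S=0)=\mathbb P(\mathcal L=0)=\exp\Big(-\sum_{k=3}^\infty\lambda_k\Big)$$ and, for all integers $t\ge 3$, $$\mathbb P(3\le\mathcal S\le t)=1-\exp\Big(-\sum_{k=3}^t\lambda_k\Big),\qquad \mathbb P(\mathcal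 L\le t)=\exp\Big(-\sum_{k=t+1}^\infty\lambda_k\Big).$$ For real random variables $X,Y$ let $d_{\mathrm{Kol}}(X,Y)=\sup_{t\in\mathbb R}|\mathbb P(X\le t)-\mathbb P(Y\le t)|$. Then: 1. There exists a constant $C>0$, depending only on the distribution of $W$, such that for all $n\ge 3$, $$d_{\mathrm{Kol}}(\mathcal C_{\min}^{(n)},\mathcal S)\le \frac{C(\log n)^3}{n}.$$ 2. There exists a constant $C>0$, depending only on the distribution of $W$, such that for all $n\ge 3$, $$d_{\mathrm{Kol}}(\mathcal C_{\max}^{(n)},\mathcal L)\le \frac{C(\log n)^3}{n}.$$ -/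

import Mathlib

open MeasureTheory ProbabilityTheory

/-- The conditional probability, given the vertex weights `w`, that the distinct vertices `i` and
`j` of the generalised random graph are joined: `w i * w j / (w i * w j + ∑ l, w l)`. -/
noncomputable def edgeProb {n : ℕ} (w : Fin n → ℝ) (i j : Fin n) : ℝ :=
  w i * w j / (w i * w j + ∑ l, w l)

open Classical in
/-- The conditional probability, given the weights `w`, that the generalised random graph equals
`g`, the edges being independent: a product over all pairs of vertices `i < j`. -/
noncomputable def graphProb {n : ℕ} (w : Fin n → ℝ) (g : SimpleGraph (Fin n)) : ℝ :=
  ∏ e : Fin n × Fin n with e.1 < e.2,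
    if g.Adj e.1 e.2 then edgeProb w e.1 e.2 else 1 - edgeProb w e.1 e.2

/-- `G` is a generalised random graph on `n` vertices whose vertex weights `V 0, …, V (n - 1)` are
i.i.d. copies of the random variable `W`: conditionally on the weights, distinct vertices `i`, `j`
are joined with probability `edgeProb V i j`, independently for distinct pairs. -/
structure IsGeneralisedRandomGraph {Ω₀ Ω : Type*} [MeasurableSpace Ω₀] [MeasurableSpace Ω]
    (P₀ : Measure Ω₀) (W : Ω₀ → ℝ) {n : ℕ} (P : Measure Ω) (V : Fin n → Ω → ℝ)
    (G : Ω → SimpleGraph (Fin n)) : Prop where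
  measurable_weight : ∀ i, Measurable (V i)
  identDistrib_weight : ∀ i, IdentDistrib (V i) W P P₀
  iIndepFun_weight : iIndepFun V P
  measurableSet_graph : ∀ g, MeasurableSet {ω | G ω = g}
  condProb_graph : ∀ g,
    P⟦{ω | G ω = g} | MeasurableSpace.comap (fun ω i => V i ω) inferInstance⟧
      =ᵐ[P] fun ω => graphProb (fun i => V i ω) g

/-- The length of a longest cycle of a graph on `n` vertices, `0` if there is no cycle
(the set of cycle lengths is bounded by `n`). The shortest length is `SimpleGraph.girth`, with the
same convention. -/
noncomputable def longestCycle {n : ℕ} (G : SimpleGraph (Fin n)) : ℕ :=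
  sSup {k | ∃ (v : Fin n) (c : G.Walk v v), c.IsCycle ∧ c.length = k}

/-- `λ_k = (E[W²] / E[W]) ^ k / (2 k)`. -/
noncomputable def cycleRate {Ω₀ : Type*} [MeasurableSpace Ω₀] (P₀ : Measure Ω₀) (W : Ω₀ → ℝ)
    (k : ℕ) : ℝ :=
  1 / (2 * (k : ℝ)) * ((∫ ω, W ω ^ 2 ∂P₀) / ∫ ω, W ω ∂P₀) ^ k

/-- `S` is a `{0, 3, 4, …}`-valued random variable with `P(S = 0) = exp (-∑_{k ≥ 3} λ_k)` and
`P(3 ≤ S ≤ t) = 1 - exp (-∑_{k = 3}^t λ_k)` for all integers `t ≥ 3`. -/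
structure IsShortestCycleLimit (lam : ℕ → ℝ) {Ω : Type*} [MeasurableSpace Ω] (P : Measure Ω)
    (S : Ω → ℕ) : Prop where
  measurable : Measurable S
  range : ∀ ω, S ω = 0 ∨ 3 ≤ S ω
  prob_zero : P.real {ω | S ω = 0} = Real.exp (-∑' k : ℕ, lam (k + 3))
  prob_le : ∀ t : ℕ, 3 ≤ t →
    P.real {ω | 3 ≤ S ω ∧ S ω ≤ t} = 1 - Real.exp (-∑ k ∈ Finset.Icc 3 t, lam k)

/-- `L` is a `{0, 3, 4, …}`-valued random variable with `P(L = 0) = exp (-∑_{k ≥ 3} λ_k)` and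
`P(L ≤ t) = exp (-∑_{k ≥ t + 1} λ_k)` for all integers `t ≥ 3`. -/
structure IsLongestCycleLimit (lam : ℕ → ℝ) {Ω : Type*} [MeasurableSpace Ω] (P : Measure Ω)
    (L : Ω → ℕ) : Prop where
  measurable : Measurable L
  range : ∀ ω, L ω = 0 ∨ 3 ≤ L ω
  prob_zero : P.real {ω | L ω = 0} = Real.exp (-∑' k : ℕ, lam (k + 3))
  prob_le : ∀ t : ℕ, 3 ≤ t →
    P.real {ω | L ω ≤ t} = Real.exp (-∑' k : ℕ, lam (k + (t + 1)))

/-- The Kolmogorov distance `sup_t |P(X ≤ t) - Q(Y ≤ t)|` of two real random variables, which may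
live on different probability spaces. -/
noncomputable def kolmogorovDist {Ω Ω' : Type*} [MeasurableSpace Ω] [MeasurableSpace Ω']
    (P : Measure Ω) (X : Ω → ℝ) (Q : Measure Ω') (Y : Ω' → ℝ) : ℝ :=
  ⨆ t : ℝ, |P.real {ω | X ω ≤ t} - Q.real {ω | Y ω ≤ t}|

/-! The remaining facts show that the notions above are realised: the limits exist whenever
`E[W²] < E[W]`, and a generalised random graph with a given weight exists for every `n`. -/

lemma exists_measure_nat_cdf (F : ℕ → ℝ) (h0 : 0 ≤ F 0) (hF : Monotone F)
    (h1 : Filter.Tendsto F Filter.atTop (nhds 1)) :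
    ∃ μ : Measure ℕ, IsProbabilityMeasure μ ∧ ∀ t, μ.real {k | k ≤ t} = F t := by
  let m : ℕ → ℝ := fun k => Nat.casesOn k (F 0) (fun j => F (j + 1) - F j)
  have hm : ∀ k, 0 ≤ m k := by
    rintro (_ | k)
    · exact h0
    · exact sub_nonneg.2 (hF (Nat.le_succ k))
  have hs : ∀ t, ∑ k ∈ Finset.range (t + 1), m k = F t := by
    intro t
    induction t with
    | zero => simp [m]
    | succ t ih => rw [Finset.sum_range_succ, ih]; simp [m]
  have hsum : HasSum m 1 := by
    rw [hasSum_iff_tendsto_nat_of_nonneg hm, ← Filter.tendsto_add_atTop_iff_nat 1]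
    simpa [hs] using h1
  let p : PMF ℕ := ⟨fun k => ENNReal.ofReal (m k), by
    have := ENNReal.ofReal_tsum_of_nonneg hm hsum.summable
    rw [hsum.tsum_eq, ENNReal.ofReal_one] at this
    rw [this]
    exact ENNReal.summable.hasSum⟩
  refine ⟨p.toMeasure, inferInstance, fun t => ?_⟩
  have hset : {k | k ≤ t} = ((Finset.range (t + 1) : Finset ℕ) : Set ℕ) := by
    ext k; simp
  have hp : ∀ k, p k = ENNReal.ofReal (m k) := fun k => rfl
  rw [Measure.real, hset, PMF.toMeasure_apply_finset]
  simp only [hp]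
  rw [← ENNReal.ofReal_sum_of_nonneg (fun k _ => hm k), hs, ENNReal.toReal_ofReal]
  rw [← hs]; exact Finset.sum_nonneg (fun k _ => hm k)

lemma exists_isShortestCycleLimit (lam : ℕ → ℝ) (h : Summable lam) (hn : ∀ k, 0 ≤ lam k) :
    ∃ μ : Measure ℕ, IsProbabilityMeasure μ ∧ ∃ S, IsShortestCycleLimit lam μ S := by
  let A := ∑' k : ℕ, lam (k + 3)
  have hlim : Filter.Tendsto (fun t => ∑ k ∈ Finset.Icc 3 t, lam k) Filter.atTop (nhds A) := by
    have h3 : Summable (fun k => lam (k+3)) := (summable_nat_add_iff 3).2 h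
    have := h3.hasSum.tendsto_sum_nat
    rw [← Filter.tendsto_add_atTop_iff_nat 2]
    refine this.congr fun n => ?_
    rw [show Finset.Icc 3 (n+2) = Finset.Ico (0+3) (n+3) by ext; simp; omega,
      ← Finset.sum_Ico_add' lam 0 n 3]
    simp
  obtain ⟨μ, hμ, hF⟩ := exists_measure_nat_cdf (fun t => Real.exp (-A) + (1 - Real.exp (-∑ k ∈ Finset.Icc 3 t, lam k)))
    (by simp; positivity) (by
      intro a b hab
      have : ∑ k ∈ Finset.Icc 3 a, lam k ≤ ∑ k ∈ Finset.Icc 3 b, lam k :=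
        Finset.sum_le_sum_of_subset_of_nonneg (Finset.Icc_subset_Icc_right hab) (fun k _ _ => hn k)
      have := Real.exp_le_exp.2 (neg_le_neg this)
      simp only; linarith) (by
      have := ((Real.continuous_exp.tendsto _).comp hlim.neg).const_sub 1 |>.const_add (Real.exp (-A))
      simpa using this)
  refine ⟨μ, hμ, fun k => if k < 3 then 0 else k, measurable_from_top, ?_, ?_, ?_⟩
  · intro k; split_ifs <;> omega
  · have := hF 2
    simp at this
    rw [← this]; congr 1; ext k; simp; omega
  · intro t ht
    have h1 := hF t
    have h2 := hF 2
    have : {ω | 3 ≤ (if ω < 3 then 0 else ω) ∧ (if ω < 3 then 0 else ω) ≤ t} = {k | k ≤ t} \ {k | k ≤ 2} := by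
      ext k; simp; split_ifs <;> omega
    rw [this, measureReal_sdiff (by intro k; simp; omega) (by measurability), h1, h2]
    simp

lemma exists_isLongestCycleLimit (lam : ℕ → ℝ) (h : Summable lam) (hn : ∀ k, 0 ≤ lam k) :
    ∃ μ : Measure ℕ, IsProbabilityMeasure μ ∧ ∃ S, IsLongestCycleLimit lam μ S := by
  obtain ⟨μ, hμ, hF⟩ := exists_measure_nat_cdf (fun t => Real.exp (-∑' k : ℕ, lam (k + (max t 2 + 1))))
    (by positivity) (by
      refine monotone_nat_of_le_succ fun t => ?_
      simp only [Real.exp_le_exp, neg_le_neg_iff]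
      rcases Nat.lt_or_ge t 2 with h2 | h2
      · rw [max_eq_right h2.le, max_eq_right (show t + 1 ≤ 2 by omega)]
      · rw [max_eq_left h2, max_eq_left (show 2 ≤ t + 1 by omega)]
        have h3 : Summable (fun k => lam (k+(t+1))) := (summable_nat_add_iff _).2 h
        rw [h3.tsum_eq_zero_add]
        have := hn (0 + (t+1))
        simp only [add_assoc, add_comm 1] at *
        linarith) (by
      have h3 := tendsto_sum_nat_add lam
      have h4 := ((Real.continuous_exp.tendsto _).comp h3.neg)
      simp at h4
      rw [← Filter.tendsto_add_atTop_iff_nat 2]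
      rw [← Filter.tendsto_add_atTop_iff_nat 3] at h4
      refine h4.congr fun t => ?_
      simp)
  refine ⟨μ, hμ, fun k => if k < 3 then 0 else k, measurable_from_top, ?_, ?_, ?_⟩
  · intro k; split_ifs <;> omega
  · have := hF 2
    simp at this
    rw [← this]; congr 1; ext k; simp; omega
  · intro t ht
    have h1 := hF t
    rw [max_eq_left (by omega)] at h1
    rw [← h1]; congr 1; ext k; simp; split_ifs <;> omega

lemma summable_cycleRate {Ω₀ : Type*} [MeasurableSpace Ω₀] (P₀ : Measure Ω₀) (W : Ω₀ → ℝ)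
    (hsub : ∫ ω, W ω ^ 2 ∂P₀ < ∫ ω, W ω ∂P₀) : Summable (cycleRate P₀ W) ∧ ∀ k, 0 ≤ cycleRate P₀ W k := by
  have h0 : 0 ≤ ∫ ω, W ω ^ 2 ∂P₀ := integral_nonneg fun _ => sq_nonneg _
  have h1 : 0 < ∫ ω, W ω ∂P₀ := h0.trans_lt hsub
  set r := (∫ ω, W ω ^ 2 ∂P₀) / ∫ ω, W ω ∂P₀ with hr
  have hr0 : 0 ≤ r := by positivity
  have hr1 : r < 1 := (div_lt_one h1).2 hsub
  have hnn : ∀ k, 0 ≤ cycleRate P₀ W k := fun k => by unfold cycleRate; rw [← hr]; positivity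
  refine ⟨Summable.of_nonneg_of_le hnn (fun k => ?_) (summable_geometric_of_lt_one hr0 hr1), hnn⟩
  unfold cycleRate
  rw [← hr]
  rcases k with _ | k
  · simp
  · refine mul_le_of_le_one_left (by positivity) ?_
    rw [div_le_one (by positivity)]
    push_cast
    have : (0:ℝ) ≤ k := k.cast_nonneg
    linarith

open Classical in
lemma sum_graphProb {n : ℕ} (w : Fin n → ℝ) : ∑ g : SimpleGraph (Fin n), graphProb w g = 1 := by
  let E := {e : Fin n × Fin n // e.1 < e.2}
  have key : ∏ e : E, (edgeProb w e.1.1 e.1.2 + (1 - edgeProb w e.1.1 e.1.2)) = 1 := by simp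
  rw [Fintype.prod_add] at key
  rw [← key]
  let mk : Finset E → SimpleGraph (Fin n) := fun s =>
    { Adj := fun i j => (∃ h : i < j, (⟨(i,j),h⟩ : E) ∈ s) ∨ (∃ h : j < i, (⟨(j,i),h⟩ : E) ∈ s)
      symm := ⟨fun i j h => h.symm⟩
      loopless := ⟨fun i h => by rcases h with ⟨h, _⟩ | ⟨h, _⟩ <;> exact lt_irrefl _ h⟩ }
  symm
  refine Finset.sum_bij' (fun s _ => mk s) (fun g _ => Finset.univ.filter (fun e : E => g.Adj e.1.1 e.1.2))
    (by simp) (by simp) ?_ ?_ ?_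
  · intro s _
    ext ⟨⟨i, j⟩, h⟩
    simp only [Finset.mem_filter, Finset.mem_univ, true_and, mk]
    have hij : i < j := h
    simp [hij, hij.not_gt]
  · intro g _
    ext i j
    simp only [mk, Finset.mem_filter, Finset.mem_univ, true_and]
    rcases lt_trichotomy i j with h | h | h
    · simp [h, h.not_gt]
    · subst h; simp
    · simp [h, h.not_gt, g.adj_comm]
  · intro s _
    unfold graphProb
    have : ∀ e : E, (mk s).Adj e.1.1 e.1.2 ↔ e ∈ s := by
      rintro ⟨⟨i, j⟩, h⟩
      have hij : i < j := h
      simp [mk, hij, hij.not_gt]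
    have h2 := Finset.prod_subtype (p := fun e : Fin n × Fin n => e.1 < e.2)
      (F := (inferInstance : Fintype E))
      (Finset.univ.filter fun e : Fin n × Fin n => e.1 < e.2) (by simp)
      (fun e => if (mk s).Adj e.1 e.2 then edgeProb w e.1 e.2 else 1 - edgeProb w e.1 e.2)
    refine Eq.trans ?_ (Eq.trans h2.symm ?_)
    swap
    · exact Finset.prod_congr (by ext; simp) fun e _ => by congr
    have h3 : ∀ e : E, (if (mk s).Adj e.1.1 e.1.2 then edgeProb w e.1.1 e.1.2
        else 1 - edgeProb w e.1.1 e.1.2) = if e ∈ s then edgeProb w e.1.1 e.1.2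
        else 1 - edgeProb w e.1.1 e.1.2 := fun e => if_congr (this e) rfl rfl
    rw [Finset.prod_congr rfl fun e _ => h3 e, Finset.prod_ite]
    congr 1
    · exact Finset.prod_congr (by ext; simp) fun _ _ => rfl
    · exact Finset.prod_congr (by ext; simp) fun _ _ => rfl

lemma measurable_graphProb {n : ℕ} (g : SimpleGraph (Fin n)) :
    Measurable fun w : Fin n → ℝ => graphProb w g := by
  classical
  unfold graphProb
  refine Finset.measurable_prod _ fun e _ => ?_
  have : Measurable fun w : Fin n → ℝ => edgeProb w e.1 e.2 := by
    unfold edgeProb; fun_prop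
  split_ifs
  · exact this
  · exact this.const_sub 1

lemma graphProb_mem_Icc {n : ℕ} (w : Fin n → ℝ) (hw : ∀ i, 0 < w i) (g : SimpleGraph (Fin n)) :
    0 ≤ graphProb w g ∧ graphProb w g ≤ 1 := by
  classical
  have h : ∀ i j, 0 ≤ edgeProb w i j ∧ edgeProb w i j ≤ 1 := fun i j => by
    have h1 := mul_pos (hw i) (hw j)
    have h2 : 0 ≤ ∑ l, w l := Finset.sum_nonneg fun l _ => (hw l).le
    unfold edgeProb
    exact ⟨by positivity, by rw [div_le_one (by positivity)]; linarith⟩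
  unfold graphProb
  constructor
  · refine Finset.prod_nonneg fun e _ => ?_
    split_ifs
    · exact (h _ _).1
    · linarith [(h e.1 e.2).2]
  · refine Finset.prod_le_one (fun e _ => ?_) fun e _ => ?_
    all_goals
      split_ifs
      · linarith [h e.1 e.2]
      · linarith [h e.1 e.2]

lemma exists_isGeneralisedRandomGraph {Ω₀ : Type*} [MeasurableSpace Ω₀] (P₀ : Measure Ω₀) [IsProbabilityMeasure P₀]
    (W : Ω₀ → ℝ) (hWm : AEMeasurable W P₀) (hWpos : ∀ᵐ ω ∂P₀, 0 < W ω) (n : ℕ) :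
    ∃ (Ω : Type) (_ : MeasurableSpace Ω) (P : Measure Ω) (V : Fin n → Ω → ℝ)
      (G : Ω → SimpleGraph (Fin n)), IsProbabilityMeasure P ∧
      IsGeneralisedRandomGraph P₀ W P V G := by
  classical
  let ν := P₀.map W
  have hν : IsProbabilityMeasure ν := Measure.isProbabilityMeasure_map hWm
  let π := Measure.pi fun _ : Fin n => ν
  have hπpos : ∀ᵐ w ∂π, ∀ i, 0 < w i := by
    have : ∀ᵐ x ∂ν, 0 < x := (ae_map_iff hWm (measurableSet_lt measurable_const measurable_id)).2 hWpos
    rw [ae_all_iff]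
    intro i
    exact (measurePreserving_eval (fun _ : Fin n => ν) i).quasiMeasurePreserving.ae this
  letI mG : MeasurableSpace (SimpleGraph (Fin n)) := ⊤
  let P : Measure ((Fin n → ℝ) × SimpleGraph (Fin n)) :=
    ∑ g, (π.withDensity fun w => ENNReal.ofReal (graphProb w g)).map fun w => (w, g)
  have hmk : ∀ g : SimpleGraph (Fin n), Measurable fun w : Fin n → ℝ => (w, g) := fun g =>
    measurable_id.prodMk measurable_const
  have hfst : P.map Prod.fst = π := by
    ext B hB
    rw [Measure.map_apply measurable_fst hB]
    simp only [P, Measure.finsetSum_apply]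
    have : ∀ g : SimpleGraph (Fin n), ((π.withDensity fun w => ENNReal.ofReal (graphProb w g)).map fun w => (w, g)) (Prod.fst ⁻¹' B) = ∫⁻ w in B, ENNReal.ofReal (graphProb w g) ∂π := fun g => by
      rw [Measure.map_apply (hmk g) (measurable_fst hB)]
      exact withDensity_apply _ hB
    simp only [this]
    rw [← lintegral_finsetSum _ fun g _ => (measurable_graphProb g).ennreal_ofReal]
    have h1 : ∀ᵐ w ∂(π.restrict B), ∑ g : SimpleGraph (Fin n), ENNReal.ofReal (graphProb w g) = 1 := by
      filter_upwards [ae_restrict_of_ae hπpos] with w hw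
      rw [← ENNReal.ofReal_sum_of_nonneg fun g _ => (graphProb_mem_Icc w hw g).1, sum_graphProb, ENNReal.ofReal_one]
    rw [lintegral_congr_ae h1]; simp
  have hP : IsProbabilityMeasure P := ⟨by
    have := congrArg (fun m => m Set.univ) hfst
    rw [Measure.map_apply measurable_fst MeasurableSet.univ] at this
    simpa using this⟩
  refine ⟨_, inferInstance, P, fun i ω => ω.1 i, Prod.snd, hP, ?_, ?_, ?_, ?_, ?_⟩
  · intro i; exact (measurable_pi_apply i).comp measurable_fst
  · intro i
    refine ⟨((measurable_pi_apply i).comp measurable_fst).aemeasurable, hWm, ?_⟩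
    have := (Measure.map_map (μ := P) (measurable_pi_apply i) measurable_fst).symm
    rw [hfst] at this
    exact this.trans (measurePreserving_eval (fun _ : Fin n => ν) i).map_eq
  · refine (iIndepFun_iff_map_fun_eq_pi_map (μ := P)
      (f := fun (i : Fin n) (ω : (Fin n → ℝ) × SimpleGraph (Fin n)) => ω.1 i) fun i =>
      ((measurable_pi_apply i).comp measurable_fst).aemeasurable).2 ?_
    refine hfst.trans ?_
    refine congrArg Measure.pi (funext fun i => ?_)
    have := (Measure.map_map (μ := P) (measurable_pi_apply i) measurable_fst).symm
    rw [hfst] at this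
    exact ((this.trans (measurePreserving_eval (fun _ : Fin n => ν) i).map_eq)).symm
  · intro g; exact measurable_snd (MeasurableSpace.measurableSet_top (s := {g}))
  · intro g
    have hm : MeasurableSpace.comap (fun ω : (Fin n → ℝ) × SimpleGraph (Fin n) => fun i => ω.1 i) inferInstance ≤ Prod.instMeasurableSpace := measurable_fst.comap_le
    have hsg : MeasurableSet {ω : (Fin n → ℝ) × SimpleGraph (Fin n) | ω.2 = g} := measurable_snd (MeasurableSpace.measurableSet_top (s := {g}))
    have hPpos : ∀ᵐ ω ∂P, ∀ i, 0 < ω.1 i := by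
      rw [← hfst] at hπpos
      exact ae_of_ae_map measurable_fst.aemeasurable hπpos
    have hint : Integrable (fun ω : (Fin n → ℝ) × SimpleGraph (Fin n) => graphProb ω.1 g) P := by
      refine Integrable.of_bound ((measurable_graphProb g).comp measurable_fst).aestronglyMeasurable 1 ?_
      filter_upwards [hPpos] with ω hω
      rw [Real.norm_eq_abs, abs_le]
      have := graphProb_mem_Icc _ hω g
      exact ⟨by linarith, this.2⟩
    symm
    refine ae_eq_condExp_of_forall_setIntegral_eq hm ((integrable_const 1).indicator hsg) (fun _ _ _ => hint.integrableOn) ?_ ?_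
    · rintro _ ⟨B, hB, rfl⟩ _
      have hB' : MeasurableSet ((fun ω : (Fin n → ℝ) × SimpleGraph (Fin n) => fun i => ω.1 i) ⁻¹' B) := measurable_fst hB
      rw [setIntegral_indicator hsg]
      have e1 : ∫ ω in (fun ω : (Fin n → ℝ) × SimpleGraph (Fin n) => fun i => ω.1 i) ⁻¹' B, graphProb ω.1 g ∂P = ∫ w in B, graphProb w g ∂π := by
        rw [← hfst, setIntegral_map hB (measurable_graphProb g).aestronglyMeasurable measurable_fst.aemeasurable]
      have e2 : P ((fun ω : (Fin n → ℝ) × SimpleGraph (Fin n) => fun i => ω.1 i) ⁻¹' B ∩ {ω | ω.2 = g}) = ∫⁻ w in B, ENNReal.ofReal (graphProb w g) ∂π := by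
        simp only [P, Measure.finsetSum_apply]
        rw [Finset.sum_eq_single g]
        · rw [Measure.map_apply (hmk g) (hB'.inter hsg), ← withDensity_apply _ hB]
          congr 1; ext w; simp
        · intro h _ hne
          rw [Measure.map_apply (hmk h) (hB'.inter hsg)]
          rw [show (fun w : Fin n → ℝ => (w, h)) ⁻¹' ((fun ω : (Fin n → ℝ) × SimpleGraph (Fin n) => fun i => ω.1 i) ⁻¹' B ∩ {ω | ω.2 = g}) = ∅ by ext w; simp [hne], measure_empty]
        · simp
      simp only [integral_const, smul_eq_mul, mul_one, Measure.real, Measure.restrict_apply MeasurableSet.univ, Set.univ_inter]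
      refine e1.trans ?_
      rw [e2, integral_eq_lintegral_of_nonneg_ae]
      · filter_upwards [ae_restrict_of_ae hπpos] with w hw
        exact (graphProb_mem_Icc w hw g).1
      · exact (measurable_graphProb g).aestronglyMeasurable
    · refine StronglyMeasurable.aestronglyMeasurable ?_
      exact ((measurable_graphProb g).comp (comap_measurable _)).stronglyMeasurable

/-! ### The random graph with fixed weights -/

/-! Fix the weights and put L = ∑ w_i, B = ∑ w_i², M = ∑ w_i⁴. The expected number of cycles of
length k is close to (B/L)^k / (2k): every vertex of a cycle lies on two of its edges and so
contributes w², and 2k sequences traverse the same cycle. Suppose B ≤ rL with r < 1, and forbid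
cycles one at a time. Forbidding A multiplies the probability of seeing no forbidden cycle by 1 -
p_A, where p_A is the probability that A is present, up to p_A times the probability that two
vertices of A remain connected once the edges of A are deleted (`abs_graphPr_avoids_insert_le`): a
different cycle sharing an edge with A must leave A and come back elsewhere. Connection
probabilities are at most a geometric series (`graphPr_reachable_le`), so the total error is
O(M/L²), uniformly in the set J of forbidden lengths (`abs_graphPr_noCycle_sub_exp_le`).

Next the weights are averaged. Estimating |B/L - ρ| with ρ = E[W²]/E[W] directly would give only
n^(-1/2). Instead exp(-cycleSum J (B/L)) is expanded around ρ (`exists_abs_graphPr_noCycle_sub_le`).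
Up to quadratic errors the linear term is a multiple of (B - ρL)/n, which has mean zero, and the
quadratic errors have mean O(1/n) by the fourth moment. Weights far from their mean obey the same
bound, since their deviation pays for the trivial estimate 1. This yields an error C/n with C
independent of J (`exists_abs_measureReal_noCycle_sub_le`).

The distribution functions of both cycle lengths are expressed through such no-cycle probabilities.
The resulting rate is C/n, and the logarithms are slack. -/

lemma edgeProb_comm {n : ℕ} (w : Fin n → ℝ) (i j : Fin n) : edgeProb w i j = edgeProb w j i := by
  simp only [edgeProb, mul_comm (w i)]

/-- The edge probability as a function of the unordered pair. -/
noncomputable def pairProb {n : ℕ} (w : Fin n → ℝ) : Sym2 (Fin n) → ℝ :=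
  Sym2.lift ⟨edgeProb w, edgeProb_comm w⟩

@[simp] lemma pairProb_mk {n : ℕ} (w : Fin n → ℝ) (i j : Fin n) :
    pairProb w s(i, j) = edgeProb w i j := rfl

lemma edgeProb_mem {n : ℕ} {w : Fin n → ℝ} (hw : ∀ i, 0 < w i) (i j : Fin n) :
    0 ≤ edgeProb w i j ∧ edgeProb w i j < 1 := by
  have h1 := mul_pos (hw i) (hw j)
  have h2 : 0 < ∑ l, w l := Finset.sum_pos (fun l _ => hw l) ⟨i, Finset.mem_univ i⟩
  unfold edgeProb
  exact ⟨by positivity, by rw [div_lt_one (by positivity)]; linarith⟩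

lemma edgeProb_le {n : ℕ} {w : Fin n → ℝ} (hw : ∀ i, 0 < w i) (i j : Fin n) :
    edgeProb w i j ≤ w i * w j / ∑ l, w l := by
  have h1 := mul_pos (hw i) (hw j)
  have h2 : 0 < ∑ l, w l := Finset.sum_pos (fun l _ => hw l) ⟨i, Finset.mem_univ i⟩
  unfold edgeProb
  gcongr
  linarith

lemma edgeProb_eq {n : ℕ} {w : Fin n → ℝ} (hw : ∀ i, 0 < w i) (i j : Fin n) :
    w i * w j / (∑ l, w l) * (1 + w i * w j / ∑ l, w l)⁻¹ = edgeProb w i j := by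
  have h1 := mul_pos (hw i) (hw j)
  have h2 : 0 < ∑ l, w l := Finset.sum_pos (fun l _ => hw l) ⟨i, Finset.mem_univ i⟩
  unfold edgeProb
  field_simp
  ring

lemma pairProb_nonneg {n : ℕ} {w : Fin n → ℝ} (hw : ∀ i, 0 < w i) (e : Sym2 (Fin n)) :
    0 ≤ pairProb w e := by
  induction e with | _ i j => exact (edgeProb_mem hw i j).1

lemma pairProb_le_one {n : ℕ} {w : Fin n → ℝ} (hw : ∀ i, 0 < w i) (e : Sym2 (Fin n)) :
    pairProb w e ≤ 1 := by
  induction e with | _ i j => exact (edgeProb_mem hw i j).2.le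

open Classical in
/-- The conditional probability, given the weights `w`, that the graph has the property `s`. -/
noncomputable def graphPr {n : ℕ} (w : Fin n → ℝ) (s : SimpleGraph (Fin n) → Prop) : ℝ :=
  ∑ g with s g, graphProb w g

section graphPr

variable {n : ℕ} {w : Fin n → ℝ}

lemma graphPr_nonneg (hw : ∀ i, 0 < w i) (s : SimpleGraph (Fin n) → Prop) : 0 ≤ graphPr w s :=
  Finset.sum_nonneg fun g _ => (graphProb_mem_Icc w hw g).1

lemma graphPr_mono (hw : ∀ i, 0 < w i) {s t : SimpleGraph (Fin n) → Prop}
    (h : ∀ g, s g → t g) : graphPr w s ≤ graphPr w t := by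
  classical
  exact Finset.sum_le_sum_of_subset_of_nonneg
    (Finset.monotone_filter_right _ fun g _ hg => h g hg) fun g _ _ => (graphProb_mem_Icc w hw g).1

lemma graphPr_true (w : Fin n → ℝ) : graphPr w (fun _ => True) = 1 := by
  classical
  rw [← sum_graphProb w, graphPr, Finset.filter_true]

lemma graphPr_le_one (hw : ∀ i, 0 < w i) (s : SimpleGraph (Fin n) → Prop) : graphPr w s ≤ 1 :=
  graphPr_true w ▸ graphPr_mono hw fun _ _ => trivial

lemma graphPr_and_add (w : Fin n → ℝ) (s t : SimpleGraph (Fin n) → Prop) :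
    graphPr w (fun g => s g ∧ t g) + graphPr w (fun g => s g ∧ ¬ t g) = graphPr w s := by
  classical
  simp only [graphPr, ← Finset.filter_filter]
  exact Finset.sum_filter_add_sum_filter_not _ _ _

lemma graphPr_exists_le (hw : ∀ i, 0 < w i) {ι : Type*} (T : Finset ι)
    (s : ι → SimpleGraph (Fin n) → Prop) :
    graphPr w (fun g => ∃ i ∈ T, s i g) ≤ ∑ i ∈ T, graphPr w (s i) := by
  classical
  induction T using Finset.induction_on with
  | empty => simp [graphPr]
  | insert a T ha ih =>
    rw [Finset.sum_insert ha, ← graphPr_and_add w _ (s a)]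
    refine add_le_add (graphPr_mono hw fun g hg => hg.2) (le_trans (graphPr_mono hw ?_) ih)
    rintro g ⟨⟨i, hi, hs⟩, hn⟩
    rcases Finset.mem_insert.1 hi with rfl | hi
    · exact absurd hs hn
    · exact ⟨i, hi, hs⟩

open Classical in
-- Deleting the edge changes a single factor, from p to 1 - p. The cross-multiplied form needs no
-- assumption on p.
lemma graphProb_mul_deleteEdge (w : Fin n → ℝ) {i j : Fin n} (hij : i < j)
    {g : SimpleGraph (Fin n)} (h : g.Adj i j) :
    graphProb w g * (1 - edgeProb w i j)
      = graphProb w (g.deleteEdges {s(i, j)}) * edgeProb w i j := by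
  have hm : (i, j) ∈ (Finset.univ.filter fun e : Fin n × Fin n => e.1 < e.2) := by simp [hij]
  unfold graphProb
  rw [← Finset.mul_prod_erase _ _ hm, ← Finset.mul_prod_erase _ _ hm]
  have : ∏ e ∈ (Finset.univ.filter fun e : Fin n × Fin n => e.1 < e.2).erase (i, j),
        (if g.Adj e.1 e.2 then edgeProb w e.1 e.2 else 1 - edgeProb w e.1 e.2) =
      ∏ e ∈ (Finset.univ.filter fun e : Fin n × Fin n => e.1 < e.2).erase (i, j),
        (if (g.deleteEdges {s(i, j)}).Adj e.1 e.2 then edgeProb w e.1 e.2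
          else 1 - edgeProb w e.1 e.2) := by
    refine Finset.prod_congr rfl ?_
    rintro ⟨a, b⟩ hab
    simp only [Finset.mem_erase, Finset.mem_filter, Finset.mem_univ, true_and, ne_eq,
      Prod.mk.injEq] at hab
    have : (g.deleteEdges {s(i, j)}).Adj a b ↔ g.Adj a b := by
      simp only [SimpleGraph.deleteEdges_adj, Set.mem_singleton_iff, Sym2.eq_iff,
        and_iff_left_iff_imp]
      rintro - (h | ⟨rfl, rfl⟩)
      · exact hab.1 h
      · exact absurd hab.2 hij.not_gt
    simp only [this]
  rw [this]
  simp only [h, if_true, SimpleGraph.deleteEdges_adj, Set.mem_singleton_iff, not_true, and_false,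
    if_false]
  ring

/-- An event that ignores `e` is written as `s (g.deleteEdges {e})`. Toggling `e` matches the graphs
with `e` and those without it; if their masses in the event are a and b, then a (1 - p) = b p, hence
a = p (a + b). -/
lemma graphPr_edge_and (w : Fin n → ℝ) {e : Sym2 (Fin n)} (he : ¬ e.IsDiag)
    (s : SimpleGraph (Fin n) → Prop) :
    graphPr w (fun g => e ∈ g.edgeSet ∧ s (g.deleteEdges {e}))
      = pairProb w e * graphPr w (fun g => s (g.deleteEdges {e})) := by
  classical
  obtain ⟨i, j, hij, rfl⟩ : ∃ i j, i < j ∧ e = s(i, j) := by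
    induction e with | _ i j =>
    rcases lt_trichotomy i j with h | h | h
    · exact ⟨i, j, h, rfl⟩
    · exact absurd h he
    · exact ⟨j, i, h, Sym2.eq_swap⟩
  have h1 := graphPr_and_add w (fun g => s (g.deleteEdges {s(i, j)})) (fun g => s(i, j) ∈ g.edgeSet)
  have h2 : graphPr w (fun g => s (g.deleteEdges {s(i, j)}) ∧ s(i, j) ∈ g.edgeSet)
      * (1 - edgeProb w i j) =
      graphPr w (fun g => s (g.deleteEdges {s(i, j)}) ∧ ¬ s(i, j) ∈ g.edgeSet)
      * edgeProb w i j := by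
    unfold graphPr
    rw [Finset.sum_mul, Finset.sum_mul]
    refine Finset.sum_bij' (fun g _ => g.deleteEdges {s(i, j)})
      (fun g _ => g ⊔ SimpleGraph.fromEdgeSet {s(i, j)}) ?_ ?_ ?_ ?_ ?_
    · intro g hg
      simp only [Finset.mem_filter, Finset.mem_univ, true_and] at hg ⊢
      refine ⟨by simpa using hg.1, by simp⟩
    · intro g hg
      simp only [Finset.mem_filter, Finset.mem_univ, true_and] at hg ⊢
      refine ⟨?_, by simp [hij.ne]⟩
      convert hg.1 using 1
      ext a b
      have := hg.2
      simp only [SimpleGraph.deleteEdges_adj, SimpleGraph.sup_adj, SimpleGraph.fromEdgeSet_adj,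
        SimpleGraph.mem_edgeSet, Set.mem_singleton_iff] at this ⊢
      tauto
    · intro g hg
      simp only [Finset.mem_filter, Finset.mem_univ, true_and, SimpleGraph.mem_edgeSet] at hg ⊢
      ext a b
      simp only [SimpleGraph.deleteEdges_adj, SimpleGraph.sup_adj, SimpleGraph.fromEdgeSet_adj,
        Set.mem_singleton_iff]
      constructor
      · rintro (h | ⟨h, -⟩)
        · exact h.1
        · rw [← SimpleGraph.mem_edgeSet, h]; exact hg.2
      · intro h
        by_cases h' : s(a, b) = s(i, j)
        · exact Or.inr ⟨h', h.ne⟩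
        · exact Or.inl ⟨h, h'⟩
    · intro g hg
      simp only [Finset.mem_filter, Finset.mem_univ, true_and, SimpleGraph.mem_edgeSet] at hg ⊢
      ext a b
      simp only [SimpleGraph.deleteEdges_adj, SimpleGraph.sup_adj, SimpleGraph.fromEdgeSet_adj,
        Set.mem_singleton_iff]
      constructor
      · tauto
      · intro h
        refine ⟨Or.inl h, fun h' => hg.2 ?_⟩
        rw [← SimpleGraph.mem_edgeSet, ← h']; exact h
    · intro g hg
      simp only [Finset.mem_filter, Finset.mem_univ, true_and, SimpleGraph.mem_edgeSet] at hg
      exact graphProb_mul_deleteEdge w hij hg.2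
  have h3 : graphPr w (fun g => s(i, j) ∈ g.edgeSet ∧ s (g.deleteEdges {s(i, j)})) =
      graphPr w (fun g => s (g.deleteEdges {s(i, j)}) ∧ s(i, j) ∈ g.edgeSet) := by
    simp only [and_comm]
  rw [h3, pairProb_mk]
  linear_combination h2 + edgeProb w i j * h1

/-- The edges in `A` are independent of the edges outside of `A`. -/
lemma graphPr_edges_and (w : Fin n → ℝ) (A : Finset (Sym2 (Fin n)))
    (hA : ∀ e ∈ A, ¬ e.IsDiag) (s : SimpleGraph (Fin n) → Prop) :
    graphPr w (fun g => (∀ e ∈ A, e ∈ g.edgeSet) ∧ s (g.deleteEdges A))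
      = (∏ e ∈ A, pairProb w e) * graphPr w (fun g => s (g.deleteEdges A)) := by
  classical
  induction A using Finset.induction_on generalizing s with
  | empty => simp
  | insert a A ha ih =>
    -- Both orders of deletion are needed: with `a` removed first the one-edge lemma applies, with
    -- `a` removed last the induction hypothesis applies to the event `s` after deletion of `a`.
    have hd : ∀ g : SimpleGraph (Fin n), g.deleteEdges (insert a A : Finset _)
        = (g.deleteEdges {a}).deleteEdges A := fun g => by
      rw [SimpleGraph.deleteEdges_deleteEdges, Finset.coe_insert, Set.insert_eq]
    have hd' : ∀ g : SimpleGraph (Fin n), g.deleteEdges (insert a A : Finset _)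
        = (g.deleteEdges A).deleteEdges {a} := fun g => by
      rw [SimpleGraph.deleteEdges_deleteEdges, Finset.coe_insert, Set.insert_eq, Set.union_comm]
    have e1 : ∀ g : SimpleGraph (Fin n), ((∀ e ∈ insert a A, e ∈ g.edgeSet) ∧
        s (g.deleteEdges (insert a A : Finset _))) ↔ (a ∈ g.edgeSet ∧
          ((∀ e ∈ A, e ∈ (g.deleteEdges {a}).edgeSet) ∧
            s ((g.deleteEdges {a}).deleteEdges A))) := fun g => by
      rw [hd, Finset.forall_mem_insert, and_assoc]
      refine and_congr_right fun _ => and_congr_left fun _ => ?_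
      refine forall₂_congr fun e he => ?_
      have : e ≠ a := fun h => ha (h ▸ he)
      simp [SimpleGraph.edgeSet_deleteEdges, this]
    have e2 : ∀ g : SimpleGraph (Fin n), ((∀ e ∈ A, e ∈ (g.deleteEdges {a}).edgeSet) ∧
            s ((g.deleteEdges {a}).deleteEdges A)) ↔
          ((∀ e ∈ A, e ∈ g.edgeSet) ∧ s ((g.deleteEdges A).deleteEdges {a})) := fun g => by
      rw [← hd, hd']
      refine and_congr_left fun _ => forall₂_congr fun e he => ?_
      have : e ≠ a := fun h => ha (h ▸ he)
      simp [SimpleGraph.edgeSet_deleteEdges, this]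
    simp only [e1]
    rw [graphPr_edge_and w (hA a (Finset.mem_insert_self a A))
      (fun g => (∀ e ∈ A, e ∈ g.edgeSet) ∧ s (g.deleteEdges A))]
    simp only [e2]
    rw [ih (fun e he => hA e (Finset.mem_insert_of_mem he)) (fun g => s (g.deleteEdges {a})),
      Finset.prod_insert ha, mul_assoc]
    simp only [hd']

lemma graphPr_edges (w : Fin n → ℝ) (A : Finset (Sym2 (Fin n)))
    (hA : ∀ e ∈ A, ¬ e.IsDiag) :
    graphPr w (fun g => ∀ e ∈ A, e ∈ g.edgeSet) = ∏ e ∈ A, pairProb w e := by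
  have := graphPr_edges_and w A hA fun _ => True
  simpa [graphPr_true] using this

end graphPr

/-! ### Connection probabilities by counting paths -/

section reachable

variable {n : ℕ} {w : Fin n → ℝ}

open Classical in
/-- The sum, over the walks of length `j` from `u` to `v` in the complete graph, of the products
of the edge probabilities. -/
noncomputable def walkSum (w : Fin n → ℝ) (j : ℕ) (u v : Fin n) : ℝ :=
  ∑ p ∈ (⊤ : SimpleGraph (Fin n)).finsetWalkLength j u v, (p.edges.map (pairProb w)).prod

lemma prod_map_pairProb_nonneg (hw : ∀ i, 0 < w i) (l : List (Sym2 (Fin n))) :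
    0 ≤ (l.map (pairProb w)).prod :=
  List.prod_nonneg fun x hx => by
    obtain ⟨e, -, rfl⟩ := List.mem_map.1 hx
    exact pairProb_nonneg hw e

lemma walkSum_zero (w : Fin n → ℝ) (u v : Fin n) :
    walkSum w 0 u v = if u = v then 1 else 0 := by
  classical
  unfold walkSum SimpleGraph.finsetWalkLength
  split_ifs with h
  · subst h; simp
  · simp

/-- Split off the first edge. Only an inequality, because the right side also admits the step from
`u` to itself. -/
lemma walkSum_succ_le (hw : ∀ i, 0 < w i) (j : ℕ) (u v : Fin n) :
    walkSum w (j + 1) u v ≤ ∑ x, edgeProb w u x * walkSum w j x v := by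
  classical
  have h1 : walkSum w (j + 1) u v ≤ ∑ x : (⊤ : SimpleGraph (Fin n)).neighborSet u,
      edgeProb w u x * walkSum w j x v := by
    unfold walkSum
    rw [SimpleGraph.finsetWalkLength]
    refine (Finset.sum_le_sum_of_subset_of_nonneg (t := Finset.univ.biUnion _) (le_refl _)
      fun _ _ _ => prod_map_pairProb_nonneg hw _).trans ?_
    rw [Finset.sum_biUnion]
    · refine Finset.sum_le_sum fun x _ => ?_
      rw [Finset.sum_map, Finset.mul_sum]
      refine Finset.sum_le_sum fun p _ => le_of_eq ?_
      have hx : (⊤ : SimpleGraph (Fin n)).Adj u x := x.2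
      change ((SimpleGraph.Walk.cons hx p).edges.map (pairProb w)).prod = _
      rw [SimpleGraph.Walk.edges_cons, List.map_cons, List.prod_cons, pairProb_mk]
    · intro x _ y _ hxy
      rw [Function.onFun, Finset.disjoint_left]
      intro p hp hq
      simp only [Finset.mem_map] at hp hq
      obtain ⟨p1, -, rfl⟩ := hp
      obtain ⟨p2, -, h⟩ := hq
      have hx : (⊤ : SimpleGraph (Fin n)).Adj u x := x.2
      have hy : (⊤ : SimpleGraph (Fin n)).Adj u y := y.2
      change SimpleGraph.Walk.cons hy p2 = SimpleGraph.Walk.cons hx p1 at h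
      rw [SimpleGraph.Walk.cons.injEq] at h
      exact hxy (Subtype.ext h.1.symm)
  refine h1.trans ?_
  refine (Finset.sum_subtype ((⊤ : SimpleGraph (Fin n)).neighborFinset u) (fun x => by simp)
    fun x => edgeProb w u x * walkSum w j x v).symm.trans_le ?_
  exact Finset.sum_le_sum_of_subset_of_nonneg (Finset.subset_univ _) fun x _ _ =>
    mul_nonneg (edgeProb_mem hw u x).1 (Finset.sum_nonneg fun p _ => prod_map_pairProb_nonneg hw _)

/-- After p_ij ≤ w_i w_j / L the sum factorises, and each inner vertex contributes ∑ w_x² / L ≤ r.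
-/
lemma walkSum_succ_le_pow (hw : ∀ i, 0 < w i) {r : ℝ} (hr : ∑ i, w i ^ 2 ≤ r * ∑ i, w i)
    (hr0 : 0 ≤ r) (j : ℕ) (u v : Fin n) :
    walkSum w (j + 1) u v ≤ w u * w v / (∑ i, w i) * r ^ j := by
  have hL : 0 < ∑ l, w l := Finset.sum_pos (fun l _ => hw l) ⟨u, Finset.mem_univ u⟩
  induction j generalizing u with
  | zero =>
    refine (walkSum_succ_le hw 0 u v).trans ?_
    simp only [walkSum_zero, mul_ite, mul_one, mul_zero, Finset.sum_ite_eq', Finset.mem_univ,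
      if_true, pow_zero]
    exact edgeProb_le hw u v
  | succ j ih =>
    refine (walkSum_succ_le hw (j + 1) u v).trans ?_
    calc ∑ x, edgeProb w u x * walkSum w (j + 1) x v
        ≤ ∑ x, (w u * w x / (∑ i, w i)) * (w x * w v / (∑ i, w i) * r ^ j) := by
          refine Finset.sum_le_sum fun x _ => mul_le_mul (edgeProb_le hw u x) (ih x) ?_ ?_
          · exact Finset.sum_nonneg fun p _ => prod_map_pairProb_nonneg hw _
          · have := hw u; have := hw x; positivity
      _ = w u * w v / (∑ i, w i) * r ^ j * ((∑ i, w i ^ 2) / ∑ i, w i) := by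
          rw [Finset.sum_div, Finset.mul_sum]
          refine Finset.sum_congr rfl fun x _ => ?_
          field_simp
      _ ≤ w u * w v / (∑ i, w i) * r ^ j * r := by
          have : (∑ i, w i ^ 2) / ∑ i, w i ≤ r := by rwa [div_le_iff₀ hL]
          have := hw u; have := hw v
          gcongr
      _ = _ := by ring

/-- Union bound over the possible connecting paths, by length, followed by the geometric series.
Restricting to walks without repeated edges makes the probability of a walk the product along its
edge list. -/
lemma graphPr_reachable_le (hw : ∀ i, 0 < w i) {r : ℝ} (hr : ∑ i, w i ^ 2 ≤ r * ∑ i, w i)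
    (hr0 : 0 ≤ r) (hr1 : r < 1) {u v : Fin n} (huv : u ≠ v) :
    graphPr w (fun g => g.Reachable u v) ≤ w u * w v / (∑ i, w i) * (1 - r)⁻¹ := by
  classical
  have hL : 0 < ∑ l, w l := Finset.sum_pos (fun l _ => hw l) ⟨u, Finset.mem_univ u⟩
  have hpos : 0 ≤ w u * w v / (∑ i, w i) := by have := hw u; have := hw v; positivity
  have h1 : graphPr w (fun g => g.Reachable u v) ≤ graphPr w (fun g => ∃ j ∈ Finset.range n,
      ∃ p ∈ ((⊤ : SimpleGraph (Fin n)).finsetWalkLength (j + 1) u v).filter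
        fun p => p.edges.Nodup, ∀ e ∈ p.edges.toFinset, e ∈ g.edgeSet) := by
    refine graphPr_mono hw fun g hg => ?_
    obtain ⟨q, hq⟩ := hg.exists_isPath
    have hlen := hq.length_lt
    rw [Fintype.card_fin] at hlen
    have h0 : q.length ≠ 0 := fun h => huv (SimpleGraph.Walk.eq_of_length_eq_zero h)
    -- A path has fewer than n edges, and at least one since `u ≠ v`; the index is the length minus
    -- one.
    refine ⟨q.length - 1, Finset.mem_range.2 (by omega), q.mapLe le_top, ?_, ?_⟩
    · rw [Finset.mem_filter, SimpleGraph.mem_finsetWalkLength_iff]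
      refine ⟨?_, ?_⟩
      · rw [SimpleGraph.Walk.length_map]; omega
      · rw [SimpleGraph.Walk.edges_mapLe_eq_edges]
        exact hq.isTrail.edges_nodup
    · intro e he
      rw [List.mem_toFinset, SimpleGraph.Walk.edges_mapLe_eq_edges] at he
      exact q.edges_subset_edgeSet he
  refine h1.trans ((graphPr_exists_le hw _ _).trans ?_)
  have h2 : ∀ j, graphPr w (fun g =>
      ∃ p ∈ ((⊤ : SimpleGraph (Fin n)).finsetWalkLength (j + 1) u v).filter
        fun p => p.edges.Nodup, ∀ e ∈ p.edges.toFinset, e ∈ g.edgeSet)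
        ≤ w u * w v / (∑ i, w i) * r ^ j := by
    intro j
    refine (graphPr_exists_le hw _ _).trans (le_trans ?_ (walkSum_succ_le_pow hw hr hr0 j u v))
    unfold walkSum
    refine le_trans (Finset.sum_le_sum fun p hp => ?_) (Finset.sum_le_sum_of_subset_of_nonneg
      (Finset.filter_subset _ _) fun _ _ _ => prod_map_pairProb_nonneg hw _)
    rw [graphPr_edges, List.prod_toFinset _ (Finset.mem_filter.1 hp).2]
    intro e he
    exact SimpleGraph.not_isDiag_of_mem_edgeSet _ (p.edges_subset_edgeSet (List.mem_toFinset.1 he))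
  refine (Finset.sum_le_sum fun j _ => h2 j).trans ?_
  rw [← Finset.mul_sum]
  refine mul_le_mul_of_nonneg_left ?_ hpos
  rw [← tsum_geometric_of_lt_one hr0 hr1]
  exact (summable_geometric_of_lt_one hr0 hr1).sum_le_tsum _ fun j _ => by positivity

end reachable

/-! ### Cycles as edge sets -/

section cycleEdges

lemma zmod_natCast_ne_zero {m j : ℕ} (h0 : j ≠ 0) (h : j < m) : (j : ZMod m) ≠ 0 := fun h' =>
  h0 (Nat.eq_zero_of_dvd_of_lt ((ZMod.natCast_eq_zero_iff _ _).1 h') h)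

lemma zmod_one_ne_zero (m : ℕ) : (1 : ZMod (m + 3)) ≠ 0 := by
  exact_mod_cast zmod_natCast_ne_zero (m := m + 3) one_ne_zero (by omega)

lemma zmod_two_ne_zero (m : ℕ) : (2 : ZMod (m + 3)) ≠ 0 := by
  exact_mod_cast zmod_natCast_ne_zero (m := m + 3) two_ne_zero (by omega)

variable {α : Type*} [DecidableEq α] {m l : ℕ}

/-- The edge set of the closed walk `f 0, f 1, …, f (m + 2), f 0`. -/
def cycleEdges (f : ZMod (m + 3) → α) : Finset (Sym2 α) :=
  Finset.univ.image fun i => s(f i, f (i + 1))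

lemma mem_cycleEdges {f : ZMod (m + 3) → α} {e : Sym2 α} :
    e ∈ cycleEdges f ↔ ∃ i, s(f i, f (i + 1)) = e := by
  simp [cycleEdges]

lemma cycleEdge_mem (f : ZMod (m + 3) → α) (i : ZMod (m + 3)) :
    s(f i, f (i + 1)) ∈ cycleEdges f := mem_cycleEdges.2 ⟨i, rfl⟩

lemma not_isDiag_of_mem_cycleEdges {f : ZMod (m + 3) → α} (hf : f.Injective) {e : Sym2 α}
    (he : e ∈ cycleEdges f) : ¬ e.IsDiag := by
  obtain ⟨i, rfl⟩ := mem_cycleEdges.1 he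
  intro h
  have := hf (Sym2.mk_isDiag_iff.1 h)
  exact zmod_one_ne_zero m (by simpa using this)

/-- If the edges i and j agreed with endpoints swapped, then i = j + 1 and j = i + 1, so 2 = 0
modulo `m + 3`. This is where length at least 3 matters. -/
lemma cycleEdge_injective {β : Type*} {f : ZMod (m + 3) → β} (hf : f.Injective) :
    Function.Injective fun i => s(f i, f (i + 1)) := by
  intro i j hij
  simp only [Sym2.eq_iff] at hij
  rcases hij with ⟨h, -⟩ | ⟨h1, h2⟩
  · exact hf h
  · have e1 := hf h1
    have e2 := hf h2
    refine absurd ?_ (zmod_two_ne_zero m)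
    linear_combination e2 - e1

lemma prod_cycleEdges {M : Type*} [CommMonoid M] {f : ZMod (m + 3) → α} (hf : f.Injective)
    (F : Sym2 α → M) : ∏ e ∈ cycleEdges f, F e = ∏ i, F s(f i, f (i + 1)) :=
  Finset.prod_image fun _ _ _ _ h => cycleEdge_injective hf h

lemma card_cycleEdges {f : ZMod (m + 3) → α} (hf : f.Injective) :
    (cycleEdges f).card = m + 3 := by
  rw [cycleEdges, Finset.card_image_of_injective _ (cycleEdge_injective hf), Finset.card_univ,
    ZMod.card]

lemma eq_of_mk_mem_cycleEdges {f : ZMod (m + 3) → α} (hf : f.Injective) {i : ZMod (m + 3)} {y : α}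
    (h : s(f i, y) ∈ cycleEdges f) : y = f (i + 1) ∨ y = f (i - 1) := by
  obtain ⟨j, hj⟩ := mem_cycleEdges.1 h
  rcases Sym2.eq_iff.1 hj with ⟨h1, h2⟩ | ⟨h1, h2⟩
  · rw [← hf h1]; exact Or.inl h2.symm
  · rw [← hf h2]; right; simp [h1]

lemma exists_eq_of_mk_mem_cycleEdges {f : ZMod (m + 3) → α} {x y : α}
    (h : s(x, y) ∈ cycleEdges f) : (∃ i, x = f i) ∧ ∃ i, y = f i := by
  obtain ⟨j, hj⟩ := mem_cycleEdges.1 h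
  rcases Sym2.eq_iff.1 hj with ⟨h1, h2⟩ | ⟨h1, h2⟩
  · exact ⟨⟨_, h1.symm⟩, _, h2.symm⟩
  · exact ⟨⟨_, h2.symm⟩, _, h1.symm⟩

lemma cycleEdges_rotate (f : ZMod (m + 3) → α) (a : ZMod (m + 3)) :
    cycleEdges (fun i => f (a + i)) = cycleEdges f := by
  ext e
  simp only [mem_cycleEdges]
  constructor
  · rintro ⟨i, rfl⟩; exact ⟨a + i, by rw [add_assoc]⟩
  · rintro ⟨i, rfl⟩; exact ⟨i - a, by congr 2 <;> ring_nf⟩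

lemma cycleEdges_reflect (f : ZMod (m + 3) → α) (a : ZMod (m + 3)) :
    cycleEdges (fun i => f (a - i)) = cycleEdges f := by
  ext e
  simp only [mem_cycleEdges]
  constructor
  · rintro ⟨i, rfl⟩; exact ⟨a - i - 1, by rw [Sym2.eq_swap]; congr 2 <;> ring_nf⟩
  · rintro ⟨i, rfl⟩; exact ⟨a - i - 1, by rw [Sym2.eq_swap]; congr 2 <;> ring_nf⟩

/-- A vertex of `f` has only two neighbours on the cycle, and injectivity of `h` forbids turning
back, so every step of `h` is forced. Indices are natural numbers because the two moduli are not
known to agree. -/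
lemma eq_rotate_of_subset {f : ZMod (m + 3) → α} {h : ZMod (l + 3) → α} (hf : f.Injective)
    (hh : h.Injective) (hsub : cycleEdges h ⊆ cycleEdges f) {a : ZMod (m + 3)}
    (h0 : h 0 = f a) (h1 : h 1 = f (a + 1)) (i : ℕ) :
    h i = f (a + i) ∧ h (i + 1) = f (a + i + 1) := by
  induction i with
  | zero => simpa using ⟨h0, h1⟩
  | succ i ih =>
    push_cast
    refine ⟨by rw [ih.2, add_assoc], ?_⟩
    have h2 := hsub (cycleEdge_mem h (i + 1))
    rw [ih.2] at h2
    rcases eq_of_mk_mem_cycleEdges hf h2 with h3 | h3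
    · rw [h3, add_assoc a]
    · rw [add_sub_cancel_right, ← ih.1] at h3
      refine absurd ?_ (zmod_two_ne_zero l)
      linear_combination hh h3

/-- The first step of `h` decides the orientation; in the backward case `f` is reversed and the
forward case applies. -/
lemma exists_rotate_or_reflect {f : ZMod (m + 3) → α} {h : ZMod (l + 3) → α} (hf : f.Injective)
    (hh : h.Injective) (hsub : cycleEdges h ⊆ cycleEdges f) :
    ∃ a : ZMod (m + 3), (∀ i : ℕ, h i = f (a + i)) ∨ ∀ i : ℕ, h i = f (a - i) := by
  have h01 := hsub (cycleEdge_mem h 0)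
  obtain ⟨a, ha⟩ := (exists_eq_of_mk_mem_cycleEdges h01).1
  rw [ha, zero_add] at h01
  refine ⟨a, ?_⟩
  rcases eq_of_mk_mem_cycleEdges hf h01 with h1 | h1
  · exact Or.inl fun i => (eq_rotate_of_subset hf hh hsub ha h1 i).1
  · right
    intro i
    have hf' : Function.Injective fun i => f (0 - i) := fun i j hij => by
      simpa using hf hij
    have := (eq_rotate_of_subset (a := -a) hf' hh (by rwa [cycleEdges_reflect])
      (by simpa using ha) (by rw [h1]; congr 1; ring) i).1
    rw [this]; congr 1; ring

/-- A cycle has no proper subcycle: `h` follows `f` forever and thus runs through all its edges,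
whatever the two lengths. -/
lemma cycleEdges_eq_of_subset {f : ZMod (m + 3) → α} {h : ZMod (l + 3) → α} (hf : f.Injective)
    (hh : h.Injective) (hsub : cycleEdges h ⊆ cycleEdges f) : cycleEdges h = cycleEdges f := by
  refine hsub.antisymm ?_
  obtain ⟨a, ha | ha⟩ := exists_rotate_or_reflect hf hh hsub
  · rw [← cycleEdges_rotate f a]
    intro e he
    obtain ⟨i, rfl⟩ := mem_cycleEdges.1 he
    obtain ⟨j, rfl⟩ := ZMod.natCast_zmod_surjective i
    have := ha (j + 1)
    push_cast at this
    rw [← ha, ← this]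
    exact cycleEdge_mem h j
  · rw [← cycleEdges_reflect f a]
    intro e he
    obtain ⟨i, rfl⟩ := mem_cycleEdges.1 he
    obtain ⟨j, rfl⟩ := ZMod.natCast_zmod_surjective i
    have := ha (j + 1)
    push_cast at this
    rw [← ha, ← this]
    exact cycleEdge_mem h j

/-- Each cycle is traversed by exactly `2 (m + 3)` sequences. -/
lemma card_cycleEdges_fiber [Fintype α] {f : ZMod (m + 3) → α} (hf : f.Injective) :
    (Finset.univ.filter fun h : ZMod (m + 3) → α =>
      h.Injective ∧ cycleEdges h = cycleEdges f).card = 2 * (m + 3) := by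
  classical
  -- The traversals are given by a starting point and an orientation. The values at 0 and 1 tell
  -- them apart, again because 2 ≠ 0.
  let T : ZMod (m + 3) × Bool → (ZMod (m + 3) → α) := fun p i =>
    f (if p.2 then p.1 + i else p.1 - i)
  have hT : Function.Injective T := by
    rintro ⟨a, x⟩ ⟨b, y⟩ hab
    have h0 := hf (congrFun hab 0)
    have h1 := hf (congrFun hab 1)
    have h2 := zmod_two_ne_zero m
    cases x <;> cases y <;> simp at h0 h1 ⊢ <;> try exact h0
    · exact h2 (by linear_combination h0 - h1)
    · exact h2 (by linear_combination h1 - h0)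
  have : (Finset.univ.filter fun h : ZMod (m + 3) → α =>
      h.Injective ∧ cycleEdges h = cycleEdges f) = Finset.univ.image T := by
    ext h
    simp only [Finset.mem_filter, Finset.mem_univ, true_and, Finset.mem_image, Prod.exists,
      Bool.exists_bool]
    constructor
    · rintro ⟨hh, he⟩
      obtain ⟨a, ha | ha⟩ := exists_rotate_or_reflect hf hh he.subset
      · refine ⟨a, Or.inr (funext fun i => ?_)⟩
        obtain ⟨j, rfl⟩ := ZMod.natCast_zmod_surjective i
        simp [T, ha]
      · refine ⟨a, Or.inl (funext fun i => ?_)⟩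
        obtain ⟨j, rfl⟩ := ZMod.natCast_zmod_surjective i
        simp [T, ha]
    · rintro ⟨a, rfl | rfl⟩
      · exact ⟨fun i j hij => by simpa [T] using hf hij, by simpa [T] using cycleEdges_reflect f a⟩
      · exact ⟨fun i j hij => by simpa [T] using hf hij, by simpa [T] using cycleEdges_rotate f a⟩
  rw [this, Finset.card_image_of_injective _ hT, Finset.card_univ, Fintype.card_prod, ZMod.card,
    Fintype.card_bool, mul_comm]

/-- If a graph contains a cycle different from the cycle `f` which shares an edge with it, then
two distinct vertices of `f` are joined by a path avoiding the edges of `f`. -/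
lemma exists_reachable_deleteEdges {f : ZMod (m + 3) → α} {h : ZMod (l + 3) → α}
    (hf : f.Injective) (hh : h.Injective) (hne : cycleEdges h ≠ cycleEdges f)
    (hnd : ¬ Disjoint (cycleEdges h) (cycleEdges f)) {g : SimpleGraph α}
    (hg : ∀ e ∈ cycleEdges h, e ∈ g.edgeSet) :
    ∃ x y, x ≠ y ∧ (g.deleteEdges (cycleEdges f)).Reachable (f x) (f y) := by
  -- The point where `h` leaves `f`. If `h` never left, going around from a shared edge would place
  -- all of `h` inside `f`, forcing equality.
  obtain ⟨i, hi, hi'⟩ : ∃ i, s(h i, h (i + 1)) ∈ cycleEdges f ∧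
      s(h (i + 1), h (i + 1 + 1)) ∉ cycleEdges f := by
    by_contra! H
    refine hne (cycleEdges_eq_of_subset hf hh fun e he => ?_)
    obtain ⟨e', h1, h2⟩ := Finset.not_disjoint_iff.1 hnd
    obtain ⟨i0, rfl⟩ := mem_cycleEdges.1 h1
    have key : ∀ k : ℕ, s(h (i0 + k), h (i0 + k + 1)) ∈ cycleEdges f := by
      intro k
      induction k with
      | zero => simpa using h2
      | succ k ih => simpa [add_assoc] using H _ ih
    obtain ⟨i, rfl⟩ := mem_cycleEdges.1 he
    obtain ⟨k, hk⟩ := ZMod.natCast_zmod_surjective (i - i0)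
    have := key k
    rwa [hk, add_sub_cancel] at this
  classical
  -- Continue along `h` to its next edge in `f`; the edge `i` itself comes back after `l + 2` steps,
  -- so this happens by then.
  have hex : ∃ j : ℕ, s(h (i + 1 + j), h (i + 1 + j + 1)) ∈ cycleEdges f := by
    refine ⟨l + 2, ?_⟩
    have : ((l + 3 : ℕ) : ZMod (l + 3)) = 0 := ZMod.natCast_self _
    have e : i + 1 + ((l + 2 : ℕ) : ZMod (l + 3)) = i := by
      push_cast at this ⊢
      linear_combination this
    rwa [e]
  have hlast : Nat.find hex ≤ l + 2 := by
    refine Nat.find_le ?_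
    have : ((l + 3 : ℕ) : ZMod (l + 3)) = 0 := ZMod.natCast_self _
    have e : i + 1 + ((l + 2 : ℕ) : ZMod (l + 3)) = i := by
      push_cast at this ⊢
      linear_combination this
    rwa [e]
  have h0 : Nat.find hex ≠ 0 := fun h => hi' (by simpa [h] using Nat.find_spec hex)
  have hreach : ∀ t : ℕ, t ≤ Nat.find hex →
      (g.deleteEdges (cycleEdges f)).Reachable (h (i + 1)) (h (i + 1 + t)) := by
    intro t
    induction t with
    | zero => intro _; simp
    | succ t ih =>
      intro ht
      refine (ih (by omega)).trans (SimpleGraph.Adj.reachable ?_)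
      rw [SimpleGraph.deleteEdges_adj]
      push_cast
      rw [← add_assoc]
      exact ⟨hg _ (cycleEdge_mem h _), Nat.find_min hex (by omega)⟩
  obtain ⟨x, hx⟩ := (exists_eq_of_mk_mem_cycleEdges hi).2
  obtain ⟨y, hy⟩ := (exists_eq_of_mk_mem_cycleEdges (Nat.find_spec hex)).1
  refine ⟨x, y, ?_, ?_⟩
  -- The number of steps lies strictly between 0 and `l + 3`, so `h` cannot have returned to the
  -- same vertex.
  · rintro rfl
    rw [← hx] at hy
    exact zmod_natCast_ne_zero (m := l + 3) h0 (by omega) (by simpa using hh hy)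
  · rw [← hx, ← hy]
    exact hreach _ le_rfl

/-- Both sides say that g contains a copy of the cycle graph; `Fin (m + 3)` and `ZMod (m + 3)` are
definitionally equal, and adjacency there means difference ±1. -/
lemma exists_cycleEdges_iff {g : SimpleGraph α} :
    (∃ (v : α) (c : g.Walk v v), c.IsCycle ∧ c.length = m + 3) ↔
      ∃ f : ZMod (m + 3) → α, f.Injective ∧ ∀ e ∈ cycleEdges f, e ∈ g.edgeSet := by
  rw [← SimpleGraph.cycleGraph_isContained_iff (by omega)]
  constructor
  · rintro ⟨F⟩
    refine ⟨fun i => F.toHom i, F.injective, fun e he => ?_⟩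
    obtain ⟨i, rfl⟩ := mem_cycleEdges.1 he
    rw [SimpleGraph.mem_edgeSet]
    refine F.toHom.map_rel ((SimpleGraph.cycleGraph_adj (n := m + 1)).2 (Or.inr ?_))
    change ((i + 1 : ZMod (m + 3)) - i) = 1
    ring
  · rintro ⟨f, hf, hg⟩
    refine ⟨⟨⟨fun i => f i, ?_⟩, hf⟩⟩
    have h1 : ∀ i, g.Adj (f i) (f (i + 1)) := fun i => hg _ (cycleEdge_mem f i)
    intro a b hab
    have hab : ((a : ZMod (m + 3)) - b) = 1 ∨ (b : ZMod (m + 3)) - a = 1 :=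
      (SimpleGraph.cycleGraph_adj (n := m + 1)).1 hab
    rcases hab with h | h
    · rw [sub_eq_iff_eq_add] at h
      rw [h, add_comm]; exact (h1 b).symm
    · rw [sub_eq_iff_eq_add] at h
      rw [h, add_comm]; exact h1 a

end cycleEdges

/-! ### Forbidding cycles one at a time -/

section avoid

variable {n : ℕ} {w : Fin n → ℝ}

/-- `A` is the edge set of a cycle. -/
def IsCycleSet (A : Finset (Sym2 (Fin n))) : Prop :=
  ∃ (m : ℕ) (f : ZMod (m + 3) → Fin n), f.Injective ∧ cycleEdges f = A

/-- Two distinct endpoints of edges in `A` are joined by a path in `g`. -/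
def HasChord (A : Finset (Sym2 (Fin n))) (g : SimpleGraph (Fin n)) : Prop :=
  ∃ u v, u ≠ v ∧ (∃ e ∈ A, u ∈ e) ∧ (∃ e ∈ A, v ∈ e) ∧ g.Reachable u v

/-- `g` contains none of the edge sets in `F`. -/
def Avoids (F : Finset (Finset (Sym2 (Fin n)))) (g : SimpleGraph (Fin n)) : Prop :=
  ∀ B ∈ F, ¬ ∀ e ∈ B, e ∈ g.edgeSet

/-- A member of `F` that disappears when `A` is deleted shares an edge with `A`, and it differs from
`A` because `A ∉ F`. -/
lemma hasChord_of_not_avoids {F : Finset (Finset (Sym2 (Fin n)))}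
    (hF : ∀ B ∈ F, IsCycleSet B) {A : Finset (Sym2 (Fin n))} (hA : IsCycleSet A) (hAF : A ∉ F)
    {g : SimpleGraph (Fin n)} (h1 : Avoids F (g.deleteEdges A)) (h2 : ¬ Avoids F g) :
    HasChord A (g.deleteEdges A) := by
  obtain ⟨B, hB, hBg⟩ : ∃ B ∈ F, ∀ e ∈ B, e ∈ g.edgeSet := by
    by_contra! H
    exact h2 fun B hB h => by
      obtain ⟨e, he, hn⟩ := H B hB
      exact hn (h e he)
  obtain ⟨l, h, hh, rfl⟩ := hF B hB
  obtain ⟨m, f, hf, rfl⟩ := hA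
  have hnd : ¬ Disjoint (cycleEdges h) (cycleEdges f) := by
    intro hd
    refine h1 _ hB fun e he => ?_
    rw [SimpleGraph.edgeSet_deleteEdges]
    exact ⟨hBg e he, fun he' => Finset.disjoint_left.1 hd he he'⟩
  obtain ⟨x, y, hxy, hr⟩ := exists_reachable_deleteEdges hf hh (fun h => hAF (h ▸ hB)) hnd hBg
  exact ⟨f x, f y, fun h => hxy (hf h), ⟨_, cycleEdge_mem f x, Sym2.mem_mk_left _ _⟩,
    ⟨_, cycleEdge_mem f y, Sym2.mem_mk_left _ _⟩, hr⟩

/-- The task is to compare P(avoid F, A present) with p P(avoid F). Testing avoidance on g minus A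
makes it independent of A. This replacement is made once in each of the two terms, and by
monotonicity the two errors have opposite signs, so each one-sided bound pays for one chord only. -/
lemma abs_graphPr_avoids_insert_le (hw : ∀ i, 0 < w i) {F : Finset (Finset (Sym2 (Fin n)))}
    (hF : ∀ B ∈ F, IsCycleSet B) {A : Finset (Sym2 (Fin n))} (hA : IsCycleSet A) (hAF : A ∉ F) :
    |graphPr w (Avoids (insert A F)) - (1 - ∏ e ∈ A, pairProb w e) * graphPr w (Avoids F)|
      ≤ (∏ e ∈ A, pairProb w e) * graphPr w (fun g => HasChord A (g.deleteEdges A)) := by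
  set p := ∏ e ∈ A, pairProb w e with hp
  have hp0 : 0 ≤ p := Finset.prod_nonneg fun e _ => pairProb_nonneg hw e
  have hd : ∀ e ∈ A, ¬ e.IsDiag := by
    obtain ⟨m, f, hf, rfl⟩ := hA
    exact fun e he => not_isDiag_of_mem_cycleEdges hf he
  have hmono : ∀ g : SimpleGraph (Fin n), Avoids F g → Avoids F (g.deleteEdges A) :=
    fun g hg B hB h => hg B hB fun e he => by
      have := h e he
      rw [SimpleGraph.edgeSet_deleteEdges] at this
      exact this.1
  have e1 := graphPr_and_add w (Avoids F) (fun g => ∀ e ∈ A, e ∈ g.edgeSet)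
  have e2 : graphPr w (Avoids (insert A F))
      = graphPr w (fun g => Avoids F g ∧ ¬ ∀ e ∈ A, e ∈ g.edgeSet) := by
    congr 1; ext g
    simp only [Avoids, Finset.forall_mem_insert]
    tauto
  have iD := graphPr_edges_and w A hd (Avoids F)
  have iE := graphPr_edges_and w A hd (HasChord A)
  rw [← hp] at iD iE
  have u1 : graphPr w (fun g => Avoids F g ∧ ∀ e ∈ A, e ∈ g.edgeSet) ≤
      graphPr w (fun g => (∀ e ∈ A, e ∈ g.edgeSet) ∧ Avoids F (g.deleteEdges A)) :=
    graphPr_mono hw fun g hg => ⟨hg.2, hmono g hg.1⟩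
  have u2 : graphPr w (Avoids F) ≤ graphPr w (fun g => Avoids F (g.deleteEdges A)) :=
    graphPr_mono hw hmono
  have u3 : graphPr w (fun g => Avoids F (g.deleteEdges A)) ≤
      graphPr w (Avoids F) + graphPr w (fun g => HasChord A (g.deleteEdges A)) := by
    rw [← graphPr_and_add w _ (Avoids F)]
    exact add_le_add (graphPr_mono hw fun g hg => hg.2)
      (graphPr_mono hw fun g hg => hasChord_of_not_avoids hF hA hAF hg.1 hg.2)
  have u4 : graphPr w (fun g => (∀ e ∈ A, e ∈ g.edgeSet) ∧ Avoids F (g.deleteEdges A)) ≤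
      graphPr w (fun g => Avoids F g ∧ ∀ e ∈ A, e ∈ g.edgeSet) +
      graphPr w (fun g => (∀ e ∈ A, e ∈ g.edgeSet) ∧ HasChord A (g.deleteEdges A)) := by
    rw [← graphPr_and_add w _ (Avoids F)]
    exact add_le_add (graphPr_mono hw fun g hg => ⟨hg.2, hg.1.1⟩)
      (graphPr_mono hw fun g hg => ⟨hg.1.1, hasChord_of_not_avoids hF hA hAF hg.1.2 hg.2⟩)
  have v2 := mul_le_mul_of_nonneg_left u2 hp0
  have v3 := mul_le_mul_of_nonneg_left u3 hp0
  rw [abs_le]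
  constructor <;> linarith

/-- Poisson approximation of the probability that none of a family of cycles is present. -/
lemma abs_graphPr_avoids_sub_exp_le (hw : ∀ i, 0 < w i) {F : Finset (Finset (Sym2 (Fin n)))}
    (hF : ∀ B ∈ F, IsCycleSet B) :
    |graphPr w (Avoids F) - Real.exp (-∑ A ∈ F, ∏ e ∈ A, pairProb w e)|
      ≤ ∑ A ∈ F, (∏ e ∈ A, pairProb w e) *
          (graphPr w (fun g => HasChord A (g.deleteEdges A)) + ∏ e ∈ A, pairProb w e) := by
  classical
  induction F using Finset.induction_on with
  | empty =>
    have : graphPr w (Avoids (∅ : Finset (Finset (Sym2 (Fin n))))) = 1 := by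
      rw [← graphPr_true w]; congr 1; ext g; simp [Avoids]
    simp [this]
  | insert A F hAF ih =>
    have ih := ih fun B hB => hF B (Finset.mem_insert_of_mem hB)
    have hA := hF A (Finset.mem_insert_self A F)
    have h1 := abs_graphPr_avoids_insert_le hw (fun B hB => hF B (Finset.mem_insert_of_mem hB))
      hA hAF
    rw [Finset.sum_insert hAF, Finset.sum_insert hAF, neg_add, Real.exp_add]
    set p := ∏ e ∈ A, pairProb w e with hp
    have hp0 : 0 ≤ p := Finset.prod_nonneg fun e _ => pairProb_nonneg hw e
    have hp1 : p ≤ 1 :=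
      Finset.prod_le_one (fun e _ => pairProb_nonneg hw e) fun e _ => pairProb_le_one hw e
    set S := ∑ A ∈ F, ∏ e ∈ A, pairProb w e with hS
    have hS0 : 0 ≤ S :=
      Finset.sum_nonneg fun A _ => Finset.prod_nonneg fun e _ => pairProb_nonneg hw e
    -- Exchanging 1 - p for exp(-p) costs p², the second part of the summand; the factor 1 - p ≤ 1
    -- keeps the accumulated error from growing.
    have h2 : |Real.exp (-p) - 1 - -p| ≤ (-p) ^ 2 := Real.abs_exp_sub_one_sub_id_le (by
      rw [abs_neg, abs_of_nonneg hp0]; exact hp1)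
    have h3 : Real.exp (-S) ≤ 1 := Real.exp_le_one_iff.2 (by linarith)
    have h4 := Real.exp_nonneg (-S)
    have h5 : |(1 - p) * (graphPr w (Avoids F) - Real.exp (-S))| ≤
        |graphPr w (Avoids F) - Real.exp (-S)| := by
      rw [abs_mul, abs_of_nonneg (by linarith : 0 ≤ 1 - p)]
      exact mul_le_of_le_one_left (abs_nonneg _) (by linarith)
    have h6 : |Real.exp (-S) * (Real.exp (-p) - 1 - -p)| ≤ p ^ 2 := by
      rw [abs_mul, abs_of_nonneg h4, ← neg_sq p]
      exact (mul_le_of_le_one_left (abs_nonneg _) h3).trans h2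
    rw [abs_le] at h1 h5 h6 ih ⊢
    constructor <;> nlinarith

open Classical in
/-- The edge sets of the cycles of length `m + 3`. -/
noncomputable def cycleSets (n m : ℕ) : Finset (Finset (Sym2 (Fin n))) :=
  (Finset.univ.filter fun f : ZMod (m + 3) → Fin n => f.Injective).image cycleEdges

open Classical in
lemma mem_cycleSets {m : ℕ} {A : Finset (Sym2 (Fin n))} :
    A ∈ cycleSets n m ↔ ∃ f : ZMod (m + 3) → Fin n, f.Injective ∧ cycleEdges f = A := by
  simp [cycleSets]

open Classical in
-- The source of the factor 1/(2k) in λ_k: sums over sequences count each cycle 2k times.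
lemma sum_cycleSets (m : ℕ) (F : Finset (Sym2 (Fin n)) → ℝ) :
    ∑ A ∈ cycleSets n m, F A = 1 / (2 * (m + 3 : ℝ)) *
      ∑ f : ZMod (m + 3) → Fin n with f.Injective, F (cycleEdges f) := by
  rw [Finset.sum_comp F cycleEdges, Finset.mul_sum, cycleSets]
  refine Finset.sum_congr rfl fun A hA => ?_
  obtain ⟨f, hf, rfl⟩ := mem_cycleSets.1 hA
  have := card_cycleEdges_fiber hf
  rw [Finset.filter_filter]
  rw [nsmul_eq_mul]
  have h2 : ((Finset.univ.filter fun h : ZMod (m + 3) → Fin n =>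
      h.Injective ∧ cycleEdges h = cycleEdges f).card : ℝ) = 2 * (m + 3) := by
    have h3 : ((2 * (m + 3) : ℕ) : ℝ) = 2 * (m + 3) := by push_cast; ring
    rw [← h3, ← this]
  rw [h2]
  field_simp

open Classical in
lemma sum_biUnion_cycleSets (J : Finset ℕ) (F : Finset (Sym2 (Fin n)) → ℝ) :
    ∑ A ∈ J.biUnion (cycleSets n), F A = ∑ m ∈ J, 1 / (2 * (m + 3 : ℝ)) *
      ∑ f : ZMod (m + 3) → Fin n with f.Injective, F (cycleEdges f) := by
  rw [Finset.sum_biUnion]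
  · exact Finset.sum_congr rfl fun m _ => sum_cycleSets m F
  · intro a _ b _ hab
    rw [Function.onFun, Finset.disjoint_left]
    intro A h1 h2
    obtain ⟨f, hf, rfl⟩ := mem_cycleSets.1 h1
    obtain ⟨h, hh, he⟩ := mem_cycleSets.1 h2
    have := congrArg Finset.card he
    rw [card_cycleEdges hf, card_cycleEdges hh] at this
    omega

/-- `g` has no cycle whose length is `m + 3` for an `m ∈ J`. -/
def NoCycle (J : Finset ℕ) (g : SimpleGraph (Fin n)) : Prop :=
  ∀ m ∈ J, ¬ ∃ (v : Fin n) (c : g.Walk v v), c.IsCycle ∧ c.length = m + 3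

open Classical in
lemma avoids_biUnion_cycleSets (J : Finset ℕ) (g : SimpleGraph (Fin n)) :
    Avoids (J.biUnion (cycleSets n)) g ↔ NoCycle J g := by
  simp only [Avoids, NoCycle, Finset.mem_biUnion, mem_cycleSets, exists_cycleEdges_iff]
  constructor
  · rintro h m hm ⟨f, hf, hg⟩
    exact h _ ⟨m, hm, f, hf, rfl⟩ hg
  · rintro h _ ⟨m, hm, f, hf, rfl⟩ hg
    exact h m hm ⟨f, hf, hg⟩

end avoid

/-! ### Sums over sequences of vertices -/

section sums

lemma prod_ite_ite {ι : Type*} [Fintype ι] [DecidableEq ι] {x y : ι} (hxy : x ≠ y)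
    (a b : ι → ℝ) (c : ι → ℝ) :
    (∏ i, if i = x then a i else if i = y then b i else c i)
      = a x * b y * ∏ i ∈ (Finset.univ.erase x).erase y, c i := by
  rw [← Finset.mul_prod_erase _ _ (Finset.mem_univ x),
    ← Finset.mul_prod_erase _ _ (Finset.mem_erase.2 ⟨hxy.symm, Finset.mem_univ y⟩), ← mul_assoc]
  simp only [if_true, hxy.symm, if_false]
  congr 1
  refine Finset.prod_congr rfl fun i hi => ?_
  simp only [Finset.mem_erase, Finset.mem_univ, and_true] at hi
  simp [hi.1, hi.2]

lemma prod_eq_mul_mul_prod_erase {ι : Type*} [Fintype ι] [DecidableEq ι] {x y : ι} (hxy : x ≠ y)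
    (c : ι → ℝ) : ∏ i, c i = c x * c y * ∏ i ∈ (Finset.univ.erase x).erase y, c i := by
  rw [← prod_ite_ite hxy]
  refine Finset.prod_congr rfl fun i _ => ?_
  split_ifs <;> simp_all

/-- A product of functions of single coordinates, summed over all sequences, factorises; two
positions carry special factors. -/
lemma sum_mul_mul_prod_erase {ι β : Type*} [Fintype ι] [DecidableEq ι] [Fintype β] {x y : ι}
    (hxy : x ≠ y) (F H c : β → ℝ) :
    ∑ f : ι → β, F (f x) * H (f y) * ∏ i ∈ (Finset.univ.erase x).erase y, c (f i)
      = (∑ b, F b) * (∑ b, H b) * (∑ b, c b) ^ (Fintype.card ι - 2) := by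
  let G : ι → β → ℝ := fun i b => if i = x then F b else if i = y then H b else c b
  have h1 : ∀ f : ι → β, F (f x) * H (f y) * ∏ i ∈ (Finset.univ.erase x).erase y, c (f i)
      = ∏ i, G i (f i) :=
    fun f =>
    (prod_ite_ite hxy (fun i => F (f i)) (fun i => H (f i)) fun i => c (f i)).symm
  rw [Finset.sum_congr rfl fun f _ => h1 f, ← Fintype.prod_sum G]
  have h2 : ∀ i : ι, ∑ b, G i b
      = if i = x then ∑ b, F b else if i = y then ∑ b, H b else ∑ b, c b := fun i => by
    simp only [G]; split_ifs <;> rfl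
  simp only [h2]
  rw [prod_ite_ite hxy (fun _ => _) (fun _ => _) (fun _ => _), Finset.prod_const,
    Finset.card_erase_of_mem (Finset.mem_erase.2 ⟨hxy.symm, Finset.mem_univ y⟩),
    Finset.card_erase_of_mem (Finset.mem_univ x), Finset.card_univ, Nat.sub_sub]

variable {ι : Type*} [Fintype ι] [DecidableEq ι] {n : ℕ}

lemma sum_cross_mul_prod_sq {x y : ι} (hxy : x ≠ y) (w : Fin n → ℝ) :
    ∑ f : ι → Fin n, w (f x) * w (f y) * ∏ i, w (f i) ^ 2
      = (∑ v, w v ^ 3) ^ 2 * (∑ v, w v ^ 2) ^ (Fintype.card ι - 2) := by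
  rw [sq, ← sum_mul_mul_prod_erase hxy]
  refine Finset.sum_congr rfl fun f _ => ?_
  rw [prod_eq_mul_mul_prod_erase hxy]
  ring

lemma sum_coincide_prod_sq {x y : ι} (hxy : x ≠ y) (w : Fin n → ℝ) :
    ∑ f : ι → Fin n, (if f x = f y then ∏ i, w (f i) ^ 2 else 0)
      = (∑ v, w v ^ 4) * (∑ v, w v ^ 2) ^ (Fintype.card ι - 2) := by
  -- Fixing the common value `v` of `f x` and `f y` decouples the coordinates.
  have h1 : ∀ v : Fin n, w v ^ 4 * (∑ v, w v ^ 2) ^ (Fintype.card ι - 2) =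
      ∑ f : ι → Fin n, (if f x = v then w (f x) ^ 2 else 0) * (if f y = v then w (f y) ^ 2 else 0) *
        ∏ i ∈ (Finset.univ.erase x).erase y, w (f i) ^ 2 := fun v => by
    rw [sum_mul_mul_prod_erase hxy (fun b => if b = v then w b ^ 2 else 0)
      (fun b => if b = v then w b ^ 2 else 0) (fun b => w b ^ 2)]
    simp
    left; ring
  rw [Finset.sum_mul]
  simp only [h1]
  rw [Finset.sum_comm]
  refine Finset.sum_congr rfl fun f _ => ?_
  rw [prod_eq_mul_mul_prod_erase hxy, ← Finset.sum_mul]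
  have : ∑ v, (if f x = v then w (f x) ^ 2 else 0) * (if f y = v then w (f y) ^ 2 else 0)
      = if f x = f y then w (f x) ^ 2 * w (f y) ^ 2 else 0 := by
    simp only [ite_mul, zero_mul, Finset.sum_ite_eq, Finset.mem_univ, if_true]
    simp only [eq_comm, mul_ite, mul_zero]
  rw [this, ite_mul, zero_mul]

lemma sum_prod_sq (w : Fin n → ℝ) :
    ∑ f : ι → Fin n, ∏ i, w (f i) ^ 2 = (∑ v, w v ^ 2) ^ Fintype.card ι := by
  rw [← Finset.card_univ, ← Finset.prod_const]
  exact (Fintype.prod_sum fun (_ : ι) v => w v ^ 2).symm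

/-- Cauchy–Schwarz for w · w²; it trades third powers for fourth powers, so that M is the only
higher sum in the error. -/
lemma sum_pow_three_sq_le {w : Fin n → ℝ} :
    (∑ v, w v ^ 3) ^ 2 ≤ (∑ v, w v ^ 2) * ∑ v, w v ^ 4 := by
  have := Finset.sum_mul_sq_le_sq_mul_sq Finset.univ (fun v => w v) (fun v => w v ^ 2)
  refine le_of_eq_of_le ?_ (this.trans_eq ?_)
  · congr 1; exact Finset.sum_congr rfl fun v _ => by ring
  · congr 1; exact Finset.sum_congr rfl fun v _ => by ring

lemma one_sub_sum_le_prod_inv {ι : Type*} (s : Finset ι) {q : ι → ℝ} (hq : ∀ i, 0 ≤ q i) :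
    1 - ∑ i ∈ s, q i ≤ ∏ i ∈ s, (1 + q i)⁻¹ ∧ ∏ i ∈ s, (1 + q i)⁻¹ ≤ 1 := by
  classical
  induction s using Finset.induction_on with
  | empty => simp
  | insert a s ha ih =>
    rw [Finset.sum_insert ha, Finset.prod_insert ha]
    have h0 := hq a
    have h1 : (1 + q a)⁻¹ ≤ 1 := inv_le_one_of_one_le₀ (by linarith)
    have h2 : 1 - q a ≤ (1 + q a)⁻¹ := by
      rw [← one_div, le_div_iff₀ (by positivity)]; nlinarith
    have h3 : 0 ≤ ∏ i ∈ s, (1 + q i)⁻¹ :=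
      Finset.prod_nonneg fun i _ => inv_nonneg.2 (by linarith [hq i])
    have h4 : 0 ≤ (1 + q a)⁻¹ := by positivity
    constructor <;> nlinarith

end sums

/-! ### Edge probabilities multiplied along a cycle -/

section cycleSums

variable {n m : ℕ} {w : Fin n → ℝ}

lemma prod_cyclic_mul (w : Fin n → ℝ) (f : ZMod (m + 3) → Fin n) (L : ℝ) :
    ∏ i, (w (f i) * w (f (i + 1)) / L) = (∏ i, w (f i) ^ 2) / L ^ (m + 3) := by
  rw [Finset.prod_div_distrib, Finset.prod_mul_distrib, Finset.prod_const, Finset.card_univ,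
    ZMod.card, Finset.prod_pow, sq]
  congr 2
  exact Fintype.prod_equiv (Equiv.addRight 1) _ _ fun i => rfl

lemma prod_edgeProb_le (hw : ∀ i, 0 < w i) (f : ZMod (m + 3) → Fin n) :
    ∏ i, edgeProb w (f i) (f (i + 1)) ≤ (∏ i, w (f i) ^ 2) / (∑ v, w v) ^ (m + 3) := by
  rw [← prod_cyclic_mul]
  exact Finset.prod_le_prod (fun i _ => (edgeProb_mem hw _ _).1) fun i _ => edgeProb_le hw _ _

/-- With q = w_i w_j / L the edge probability is q / (1 + q), and ∏ (1 + q)⁻¹ ≥ 1 - ∑ q. -/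
lemma le_prod_edgeProb (hw : ∀ i, 0 < w i) (f : ZMod (m + 3) → Fin n) :
    (∏ i, w (f i) ^ 2) / (∑ v, w v) ^ (m + 3) *
      (1 - ∑ i, w (f i) * w (f (i + 1)) / ∑ v, w v) ≤ ∏ i, edgeProb w (f i) (f (i + 1)) := by
  have hL : 0 ≤ ∑ l, w l := Finset.sum_nonneg fun l _ => (hw l).le
  have h : ∀ i, 0 ≤ w (f i) * w (f (i + 1)) / ∑ v, w v := fun i => by
    have := hw (f i); have := hw (f (i + 1)); positivity
  simp only [← edgeProb_eq hw]
  rw [Finset.prod_mul_distrib, prod_cyclic_mul]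
  exact mul_le_mul_of_nonneg_left (one_sub_sum_le_prod_inv _ h).1 (by positivity)

end cycleSums

/-! ### Poisson approximation for fixed weights -/

section poisson

variable {n m : ℕ} {w : Fin n → ℝ} {r : ℝ}

/-- The sum of `x ^ k / (2 k)` over the lengths `k = m + 3` with `m ∈ J`. -/
noncomputable def cycleSum (J : Finset ℕ) (x : ℝ) : ℝ :=
  ∑ m ∈ J, 1 / (2 * (m + 3 : ℝ)) * x ^ (m + 3)

/-- The marked positions carry w³ and the others w². By Cauchy–Schwarz the sum is at most
(B/L)^(m+2) M/L²; one factor B/L ≤ 1 is dropped to match `sum_coincide_le`. -/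
lemma sum_cross_le (hL : 0 < ∑ v, w v)
    (hr : ∑ v, w v ^ 2 ≤ r * ∑ v, w v) (hr1 : r ≤ 1) {x y : ZMod (m + 3)} (hxy : x ≠ y) :
    ∑ f : ZMod (m + 3) → Fin n, (∏ i, w (f i) ^ 2) / (∑ v, w v) ^ (m + 3) *
      (w (f x) * w (f y) / ∑ v, w v)
      ≤ r ^ (m + 1) * ((∑ v, w v ^ 4) / (∑ v, w v) ^ 2) := by
  have h1 := sum_cross_mul_prod_sq hxy w
  rw [ZMod.card, show m + 3 - 2 = m + 1 by omega] at h1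
  set L := ∑ v, w v
  set B := ∑ v, w v ^ 2
  have hB : 0 ≤ B := Finset.sum_nonneg fun v _ => sq_nonneg _
  have hM : 0 ≤ ∑ v, w v ^ 4 := Finset.sum_nonneg fun v _ => by positivity
  have hx : B / L ≤ r := by rwa [div_le_iff₀ hL]
  have hx0 : 0 ≤ B / L := by positivity
  have e : ∑ f : ZMod (m + 3) → Fin n, (∏ i, w (f i) ^ 2) / L ^ (m + 3) *
      (w (f x) * w (f y) / L) = (∑ v, w v ^ 3) ^ 2 * B ^ (m + 1) / L ^ (m + 4) := by
    rw [← h1, Finset.sum_div]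
    refine Finset.sum_congr rfl fun f _ => ?_
    rw [pow_succ L (m + 3)]
    field_simp
  rw [e]
  calc (∑ v, w v ^ 3) ^ 2 * B ^ (m + 1) / L ^ (m + 4)
      ≤ (B * ∑ v, w v ^ 4) * B ^ (m + 1) / L ^ (m + 4) := by
        gcongr; exact sum_pow_three_sq_le
    _ = (B / L) ^ (m + 1) * (B / L) * ((∑ v, w v ^ 4) / L ^ 2) := by
        rw [div_pow]
        field_simp
        ring
    _ ≤ r ^ (m + 1) * 1 * ((∑ v, w v ^ 4) / L ^ 2) := by
        have h0 : 0 ≤ r := hx0.trans hx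
        have h1 : B / L ≤ 1 := hx.trans hr1
        gcongr
    _ = _ := by ring

lemma sum_coincide_le (hL : 0 < ∑ v, w v)
    (hr : ∑ v, w v ^ 2 ≤ r * ∑ v, w v) {x y : ZMod (m + 3)} (hxy : x ≠ y) :
    ∑ f : ZMod (m + 3) → Fin n,
      (if f x = f y then (∏ i, w (f i) ^ 2) / (∑ v, w v) ^ (m + 3) else 0)
      ≤ r ^ (m + 1) * ((∑ v, w v ^ 4) / (∑ v, w v) ^ 2) := by
  have h1 := sum_coincide_prod_sq hxy w
  rw [ZMod.card, show m + 3 - 2 = m + 1 by omega] at h1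
  set L := ∑ v, w v
  set B := ∑ v, w v ^ 2
  have hB : 0 ≤ B := Finset.sum_nonneg fun v _ => sq_nonneg _
  have hM : 0 ≤ ∑ v, w v ^ 4 := Finset.sum_nonneg fun v _ => by positivity
  have hx : B / L ≤ r := by rwa [div_le_iff₀ hL]
  have e : ∑ f : ZMod (m + 3) → Fin n,
      (if f x = f y then (∏ i, w (f i) ^ 2) / L ^ (m + 3) else 0)
      = (∑ v, w v ^ 4) * B ^ (m + 1) / L ^ (m + 3) := by
    rw [← h1, Finset.sum_div]
    refine Finset.sum_congr rfl fun f _ => ?_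
    split_ifs
    · rfl
    · simp
  rw [e]
  calc (∑ v, w v ^ 4) * B ^ (m + 1) / L ^ (m + 3)
      = (B / L) ^ (m + 1) * ((∑ v, w v ^ 4) / L ^ 2) := by
        rw [div_pow]
        field_simp
        ring
    _ ≤ _ := by gcongr

lemma prod_sq_div_nonneg (hL : 0 < ∑ v, w v) (f : ZMod (m + 3) → Fin n) :
    0 ≤ (∏ i, w (f i) ^ 2) / (∑ v, w v) ^ (m + 3) :=
  div_nonneg (Finset.prod_nonneg fun _ _ => sq_nonneg _) (by positivity)

lemma card_offDiag_le (m : ℕ) :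
    (((Finset.univ : Finset (ZMod (m + 3))).offDiag.card : ℕ) : ℝ) ≤ (m + 3 : ℝ) ^ 2 := by
  rw [Finset.offDiag_card, Finset.card_univ, ZMod.card]
  have : (m + 3) * (m + 3) - (m + 3) ≤ (m + 3) ^ 2 := by rw [sq]; exact Nat.sub_le _ _
  exact_mod_cast this

open Classical in
-- Over all sequences, with w_i w_j / L in place of the edge probabilities, the sum is exactly
-- (B/L)^(m+3). Two corrections remain: sequences with a repeated vertex (`sum_coincide_le`) and the
-- denominators 1 + q (`sum_cross_le`).
lemma abs_sum_injective_sub_le (hw : ∀ i, 0 < w i) (hL : 0 < ∑ v, w v)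
    (hr : ∑ v, w v ^ 2 ≤ r * ∑ v, w v) (hr0 : 0 ≤ r) (hr1 : r ≤ 1) :
    |(∑ f : ZMod (m + 3) → Fin n with f.Injective, ∏ i, edgeProb w (f i) (f (i + 1)))
        - ((∑ v, w v ^ 2) / ∑ v, w v) ^ (m + 3)|
      ≤ 2 * (m + 3 : ℝ) ^ 2 * (r ^ (m + 1) * ((∑ v, w v ^ 4) / (∑ v, w v) ^ 2)) := by
  set t : (ZMod (m + 3) → Fin n) → ℝ := fun f => (∏ i, w (f i) ^ 2) / (∑ v, w v) ^ (m + 3)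
    with ht
  set X := r ^ (m + 1) * ((∑ v, w v ^ 4) / (∑ v, w v) ^ 2) with hX
  have hX0 : 0 ≤ X := by
    have hM : 0 ≤ ∑ v, w v ^ 4 := Finset.sum_nonneg fun v _ => by positivity
    positivity
  have ht0 : ∀ f, 0 ≤ t f := fun f => prod_sq_div_nonneg hL f
  have htot : ∑ f, t f = ((∑ v, w v ^ 2) / ∑ v, w v) ^ (m + 3) := by
    simp only [ht]
    rw [← Finset.sum_div, sum_prod_sq, ZMod.card, div_pow]
  have hsplit := Finset.sum_filter_add_sum_filter_not Finset.univ
    (fun f : ZMod (m + 3) → Fin n => f.Injective) t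
  have hcard := card_offDiag_le m
  have hnon : ∑ f with ¬ Function.Injective f, t f ≤ (m + 3 : ℝ) ^ 2 * X := by
    calc ∑ f with ¬ Function.Injective f, t f
        ≤ ∑ f, ∑ p ∈ (Finset.univ : Finset (ZMod (m + 3))).offDiag,
            (if f p.1 = f p.2 then t f else 0) := by
          rw [Finset.sum_filter]
          refine Finset.sum_le_sum fun f _ => ?_
          have hnn : ∀ p ∈ (Finset.univ : Finset (ZMod (m + 3))).offDiag,
              0 ≤ (if f p.1 = f p.2 then t f else 0) := fun p _ => by
            split_ifs <;> simp [ht0]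
          split_ifs with h
          · exact Finset.sum_nonneg hnn
          · obtain ⟨x, y, hxy, hne⟩ := Function.not_injective_iff.1 h
            have hm : (x, y) ∈ (Finset.univ : Finset (ZMod (m + 3))).offDiag := by simp [hne]
            refine le_trans ?_ (Finset.single_le_sum hnn hm)
            simp [hxy]
      _ = ∑ p ∈ (Finset.univ : Finset (ZMod (m + 3))).offDiag,
            ∑ f, (if f p.1 = f p.2 then t f else 0) := Finset.sum_comm
      _ ≤ ∑ p ∈ (Finset.univ : Finset (ZMod (m + 3))).offDiag, X :=
          Finset.sum_le_sum fun p hp => sum_coincide_le hL hr (Finset.mem_offDiag.1 hp).2.2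
      _ ≤ (m + 3 : ℝ) ^ 2 * X := by
          rw [Finset.sum_const, nsmul_eq_mul]; gcongr
  have hinj : ∑ f with Function.Injective f, t f -
      ∑ f : ZMod (m + 3) → Fin n with f.Injective, ∏ i, edgeProb w (f i) (f (i + 1))
        ≤ (m + 3 : ℝ) ^ 2 * X := by
    rw [← Finset.sum_sub_distrib]
    calc ∑ f with Function.Injective f, (t f - ∏ i, edgeProb w (f i) (f (i + 1)))
        ≤ ∑ f, ∑ i, t f * (w (f i) * w (f (i + 1)) / ∑ v, w v) := by
          refine (Finset.sum_le_sum fun f _ => ?_).trans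
            (Finset.sum_le_sum_of_subset_of_nonneg (Finset.filter_subset _ _) fun f _ _ => ?_)
          · have := le_prod_edgeProb hw f
            rw [← Finset.mul_sum]
            simp only [ht]
            linarith
          · refine Finset.sum_nonneg fun i _ => mul_nonneg (ht0 f) ?_
            have := hw (f i); have := hw (f (i + 1)); positivity
      _ = ∑ i, ∑ f, t f * (w (f i) * w (f (i + 1)) / ∑ v, w v) := Finset.sum_comm
      _ ≤ ∑ i : ZMod (m + 3), X := Finset.sum_le_sum fun i _ =>
          sum_cross_le hL hr hr1 fun h => zmod_one_ne_zero m (by simpa using h.symm)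
      _ ≤ (m + 3 : ℝ) ^ 2 * X := by
          rw [Finset.sum_const, nsmul_eq_mul, Finset.card_univ, ZMod.card]
          gcongr
          push_cast
          nlinarith [Nat.cast_nonneg (α := ℝ) m]
  have hle : ∑ f : ZMod (m + 3) → Fin n with f.Injective, ∏ i, edgeProb w (f i) (f (i + 1)) ≤
      ∑ f with Function.Injective f, t f := Finset.sum_le_sum fun f _ => prod_edgeProb_le hw f
  have hnon0 : 0 ≤ ∑ f with ¬ Function.Injective f, t f := Finset.sum_nonneg fun f _ => ht0 f
  rw [← htot, abs_le]
  constructor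
  · linarith
  · have : 0 ≤ (m + 3 : ℝ) ^ 2 * X := by positivity
    linarith

/-- Union bound over pairs of positions on the cycle; deleting edges can only destroy connections.
-/
lemma graphPr_hasChord_le (hw : ∀ i, 0 < w i)
    (hr : ∑ v, w v ^ 2 ≤ r * ∑ v, w v) (hr0 : 0 ≤ r) (hr1 : r < 1) (f : ZMod (m + 3) → Fin n)
    (A : Set (Sym2 (Fin n))) :
    graphPr w (fun g => HasChord (cycleEdges f) (g.deleteEdges A)) ≤
      ∑ p ∈ (Finset.univ : Finset (ZMod (m + 3))).offDiag,
        w (f p.1) * w (f p.2) / (∑ v, w v) * (1 - r)⁻¹ := by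
  classical
  have hv : ∀ u, (∃ e ∈ cycleEdges f, u ∈ e) → ∃ i, f i = u := by
    rintro u ⟨e, he, hu⟩
    obtain ⟨i, rfl⟩ := mem_cycleEdges.1 he
    rcases Sym2.mem_iff.1 hu with rfl | rfl
    · exact ⟨_, rfl⟩
    · exact ⟨_, rfl⟩
  let T := (Finset.univ : Finset (ZMod (m + 3))).offDiag.filter fun p => f p.1 ≠ f p.2
  calc graphPr w (fun g => HasChord (cycleEdges f) (g.deleteEdges A))
      ≤ graphPr w (fun g => ∃ p ∈ T, g.Reachable (f p.1) (f p.2)) := by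
        refine graphPr_mono hw ?_
        rintro g ⟨u, v, huv, hu, hv', hr⟩
        obtain ⟨x, rfl⟩ := hv u hu
        obtain ⟨y, rfl⟩ := hv v hv'
        refine ⟨(x, y), ?_, hr.mono (SimpleGraph.deleteEdges_le _)⟩
        simp only [T, Finset.mem_filter, Finset.mem_offDiag, Finset.mem_univ, true_and]
        exact ⟨fun h => huv (congrArg f h), huv⟩
    _ ≤ ∑ p ∈ T, graphPr w (fun g => g.Reachable (f p.1) (f p.2)) := graphPr_exists_le hw _ _
    _ ≤ ∑ p ∈ T, w (f p.1) * w (f p.2) / (∑ v, w v) * (1 - r)⁻¹ :=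
        Finset.sum_le_sum fun p hp =>
          graphPr_reachable_le hw hr hr0 hr1 (Finset.mem_filter.1 hp).2
    _ ≤ _ := by
        refine Finset.sum_le_sum_of_subset_of_nonneg (Finset.filter_subset _ _) fun p _ _ => ?_
        have := hw (f p.1)
        have := hw (f p.2)
        have : 0 ≤ ∑ v, w v := Finset.sum_nonneg fun v _ => (hw v).le
        have : 0 < 1 - r := by linarith
        positivity

/-- One edge, at positions 0 and 1, already bounds the product. Hence the p_A² errors are controlled
by the same sums as the chords. -/
lemma prod_edgeProb_le_cross (hw : ∀ i, 0 < w i) (hr0 : 0 ≤ r) (hr1 : r < 1)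
    (f : ZMod (m + 3) → Fin n) :
    ∏ i, edgeProb w (f i) (f (i + 1)) ≤
      ∑ p ∈ (Finset.univ : Finset (ZMod (m + 3))).offDiag,
        w (f p.1) * w (f p.2) / (∑ v, w v) * (1 - r)⁻¹ := by
  classical
  have hL : 0 ≤ ∑ v, w v := Finset.sum_nonneg fun v _ => (hw v).le
  have h1 : 1 ≤ (1 - r)⁻¹ := (one_le_inv₀ (by linarith)).2 (by linarith)
  have hnn : ∀ p : ZMod (m + 3) × ZMod (m + 3), 0 ≤ w (f p.1) * w (f p.2) / (∑ v, w v) :=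
    fun p => by have := hw (f p.1); have := hw (f p.2); positivity
  have hm : ((0 : ZMod (m + 3)), (0 + 1 : ZMod (m + 3))) ∈
      (Finset.univ : Finset (ZMod (m + 3))).offDiag := by
    simp [(zmod_one_ne_zero m).symm]
  refine le_trans ?_ (Finset.single_le_sum (fun p _ => mul_nonneg (hnn p) (by linarith)) hm)
  rw [← Finset.mul_prod_erase _ _ (Finset.mem_univ (0 : ZMod (m + 3)))]
  have h2 : ∏ i ∈ (Finset.univ : Finset (ZMod (m + 3))).erase 0, edgeProb w (f i) (f (i + 1)) ≤ 1 :=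
    Finset.prod_le_one (fun i _ => (edgeProb_mem hw _ _).1) fun i _ => (edgeProb_mem hw _ _).2.le
  calc _ ≤ edgeProb w (f 0) (f (0 + 1)) * 1 := by
        exact mul_le_mul_of_nonneg_left h2 (edgeProb_mem hw _ _).1
    _ ≤ w (f 0) * w (f (0 + 1)) / (∑ v, w v) * 1 :=
        mul_le_mul_of_nonneg_right (edgeProb_le hw _ _) zero_le_one
    _ ≤ _ := mul_le_mul_of_nonneg_left h1 (hnn (0, 0 + 1))

open Classical in
lemma sum_injective_chord_le (hw : ∀ i, 0 < w i) (hL : 0 < ∑ v, w v)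
    (hr : ∑ v, w v ^ 2 ≤ r * ∑ v, w v) (hr0 : 0 ≤ r) (hr1 : r < 1) :
    (∑ f : ZMod (m + 3) → Fin n with f.Injective, (∏ e ∈ cycleEdges f, pairProb w e) *
        (graphPr w (fun g => HasChord (cycleEdges f) (g.deleteEdges (cycleEdges f)))
          + ∏ e ∈ cycleEdges f, pairProb w e))
      ≤ 2 * (m + 3 : ℝ) ^ 2 * (1 - r)⁻¹ *
          (r ^ (m + 1) * ((∑ v, w v ^ 4) / (∑ v, w v) ^ 2)) := by
  have hinv : 0 ≤ (1 - r)⁻¹ := inv_nonneg.2 (by linarith)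
  set X := r ^ (m + 1) * ((∑ v, w v ^ 4) / (∑ v, w v) ^ 2) with hX
  have hX0 : 0 ≤ X := by
    have hM : 0 ≤ ∑ v, w v ^ 4 := Finset.sum_nonneg fun v _ => by positivity
    positivity
  set t : (ZMod (m + 3) → Fin n) → ℝ := fun f => (∏ i, w (f i) ^ 2) / (∑ v, w v) ^ (m + 3)
    with ht
  have ht0 : ∀ f, 0 ≤ t f := fun f => prod_sq_div_nonneg hL f
  have hnn : ∀ (f : ZMod (m + 3) → Fin n) (p : ZMod (m + 3) × ZMod (m + 3)), 0 ≤ w (f p.1) * w (f p.2) / (∑ v, w v) :=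
    fun f p => by have := hw (f p.1); have := hw (f p.2); positivity
  calc _ ≤ ∑ f : ZMod (m + 3) → Fin n, ∑ p ∈ (Finset.univ : Finset (ZMod (m + 3))).offDiag,
        2 * (1 - r)⁻¹ * (t f * (w (f p.1) * w (f p.2) / (∑ v, w v))) := by
        refine (Finset.sum_le_sum fun f hf => ?_).trans
            (Finset.sum_le_sum_of_subset_of_nonneg (Finset.filter_subset _ _) fun f _ _ => ?_)
        · have hf := (Finset.mem_filter.1 hf).2
          rw [prod_cycleEdges hf]
          simp only [pairProb_mk]
          refine (mul_le_mul (prod_edgeProb_le hw f) (add_le_add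
            (graphPr_hasChord_le hw hr hr0 hr1 f _) (prod_edgeProb_le_cross hw hr0 hr1 f))
            (add_nonneg (graphPr_nonneg hw _) (Finset.prod_nonneg fun i _ =>
              (edgeProb_mem hw _ _).1)) (ht0 f)).trans_eq ?_
          rw [← two_mul, Finset.mul_sum, Finset.mul_sum]
          refine Finset.sum_congr rfl fun p _ => ?_
          simp only [ht]
          ring
        · exact Finset.sum_nonneg fun p _ => mul_nonneg (by positivity)
            (mul_nonneg (ht0 f) (hnn f p))
    _ = ∑ p ∈ (Finset.univ : Finset (ZMod (m + 3))).offDiag, 2 * (1 - r)⁻¹ *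
          ∑ f : ZMod (m + 3) → Fin n, t f * (w (f p.1) * w (f p.2) / (∑ v, w v)) := by
        rw [Finset.sum_comm]
        exact Finset.sum_congr rfl fun p _ => (Finset.mul_sum _ _ _).symm
    _ ≤ ∑ p ∈ (Finset.univ : Finset (ZMod (m + 3))).offDiag, 2 * (1 - r)⁻¹ * X :=
        Finset.sum_le_sum fun p hp => mul_le_mul_of_nonneg_left
          (sum_cross_le hL hr hr1.le (Finset.mem_offDiag.1 hp).2.2) (by positivity)
    _ ≤ (m + 3 : ℝ) ^ 2 * (2 * (1 - r)⁻¹ * X) := by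
        rw [Finset.sum_const, nsmul_eq_mul]
        exact mul_le_mul_of_nonneg_right (card_offDiag_le m) (by positivity)
    _ = _ := by ring

lemma summable_mul_pow (hr0 : 0 ≤ r) (hr1 : r < 1) :
    Summable fun m : ℕ => (m + 3 : ℝ) * r ^ (m + 1) := by
  have h1 := (summable_pow_mul_geometric_of_norm_lt_one 1
    (by rwa [Real.norm_eq_abs, abs_of_nonneg hr0] : ‖r‖ < 1)).mul_right r
  have h2 := (summable_geometric_of_lt_one hr0 hr1).mul_right (3 * r)
  refine (h1.add h2).congr fun m => ?_
  simp only [pow_one]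
  ring

lemma abs_exp_neg_sub_exp_neg_le {a b : ℝ} (ha : 0 ≤ a) (hb : 0 ≤ b) :
    |Real.exp (-a) - Real.exp (-b)| ≤ |a - b| := by
  have key : ∀ a b : ℝ, 0 ≤ a → Real.exp (-a) - Real.exp (-b) ≤ |a - b| := by
    intro a b ha
    have h1 : Real.exp (-b) = Real.exp (-a) * Real.exp (a - b) := by
      rw [← Real.exp_add]; congr 1; ring
    have h2 := Real.add_one_le_exp (a - b)
    have h3 : Real.exp (-a) ≤ 1 := Real.exp_le_one_iff.2 (by linarith)
    have h4 := Real.exp_pos (-a)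
    have h5 := neg_le_abs (a - b)
    have h6 := abs_nonneg (a - b)
    rw [h1]
    nlinarith
  rw [abs_le]
  have h1 := key a b ha
  have h2 := key b a hb
  rw [abs_sub_comm b a] at h2
  constructor <;> linarith

lemma cycleSum_nonneg (J : Finset ℕ) {x : ℝ} (hx : 0 ≤ x) : 0 ≤ cycleSum J x :=
  Finset.sum_nonneg fun m _ => by positivity

/-- The constant of the Poisson approximation. -/
noncomputable def poissonConst (r : ℝ) : ℝ :=
  (1 + (1 - r)⁻¹) * ∑' m : ℕ, (m + 3 : ℝ) * r ^ (m + 1)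

lemma poissonConst_nonneg (hr0 : 0 ≤ r) (hr1 : r < 1) : 0 ≤ poissonConst r :=
  mul_nonneg (add_nonneg zero_le_one (inv_nonneg.2 (by linarith)))
    (tsum_nonneg fun m => by positivity)

/-- For fixed weights, the probability that there is no cycle of certain lengths is close to
the corresponding Poisson probability. -/
theorem abs_graphPr_noCycle_sub_exp_le (hw : ∀ i, 0 < w i) (hL : 0 < ∑ v, w v)
    (hr : ∑ v, w v ^ 2 ≤ r * ∑ v, w v) (hr0 : 0 ≤ r) (hr1 : r < 1) (J : Finset ℕ) :
    |graphPr w (NoCycle J) - Real.exp (-cycleSum J ((∑ v, w v ^ 2) / ∑ v, w v))|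
      ≤ poissonConst r * ((∑ v, w v ^ 4) / (∑ v, w v) ^ 2) := by
  classical
  have hinv : 0 ≤ (1 - r)⁻¹ := inv_nonneg.2 (by linarith)
  have hM : 0 ≤ (∑ v, w v ^ 4) / (∑ v, w v) ^ 2 :=
    div_nonneg (Finset.sum_nonneg fun v _ => by positivity) (by positivity)
  set X := (∑ v, w v ^ 4) / (∑ v, w v) ^ 2 with hX
  set x := (∑ v, w v ^ 2) / ∑ v, w v with hx
  have hx0 : 0 ≤ x := div_nonneg (Finset.sum_nonneg fun v _ => sq_nonneg _) hL.le
  have h1 := abs_graphPr_avoids_sub_exp_le hw (F := J.biUnion (cycleSets n)) (by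
    intro B hB
    obtain ⟨m, -, hm⟩ := Finset.mem_biUnion.1 hB
    obtain ⟨f, hf, rfl⟩ := mem_cycleSets.1 hm
    exact ⟨m, f, hf, rfl⟩)
  have e1 : Avoids (J.biUnion (cycleSets n)) = NoCycle J :=
    funext fun g => propext (avoids_biUnion_cycleSets J g)
  rw [sum_biUnion_cycleSets, sum_biUnion_cycleSets, e1] at h1
  set S := ∑ m ∈ J, 1 / (2 * (m + 3 : ℝ)) *
      ∑ f : ZMod (m + 3) → Fin n with f.Injective, ∏ e ∈ cycleEdges f, pairProb w e with hS
  have hS0 : 0 ≤ S := Finset.sum_nonneg fun m _ => mul_nonneg (by positivity)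
    (Finset.sum_nonneg fun f _ => Finset.prod_nonneg fun e _ => pairProb_nonneg hw e)
  -- With k = m + 3, the factors 1/(2k) and 2k² leave k r^(m+1), whose series converges; this makes
  -- the final bound uniform in `J`.
  have h2 : |S - cycleSum J x| ≤ ∑ m ∈ J, (m + 3 : ℝ) * r ^ (m + 1) * X := by
    rw [hS, cycleSum, ← Finset.sum_sub_distrib]
    refine (Finset.abs_sum_le_sum_abs _ _).trans (Finset.sum_le_sum fun m _ => ?_)
    rw [← mul_sub, abs_mul, abs_of_nonneg (by positivity)]
    have e2 : ∑ f : ZMod (m + 3) → Fin n with f.Injective, ∏ e ∈ cycleEdges f, pairProb w e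
        = ∑ f : ZMod (m + 3) → Fin n with f.Injective, ∏ i, edgeProb w (f i) (f (i + 1)) := by
      refine Finset.sum_congr rfl fun f hf => ?_
      rw [prod_cycleEdges (Finset.mem_filter.1 hf).2]
      simp only [pairProb_mk]
    rw [e2]
    refine (mul_le_mul_of_nonneg_left (abs_sum_injective_sub_le hw hL hr hr0 hr1.le)
      (by positivity)).trans_eq ?_
    rw [← hX]
    field_simp
  have h3 : ∑ m ∈ J, 1 / (2 * (m + 3 : ℝ)) *
      ∑ f : ZMod (m + 3) → Fin n with f.Injective, (∏ e ∈ cycleEdges f, pairProb w e) *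
        (graphPr w (fun g => HasChord (cycleEdges f) (g.deleteEdges (cycleEdges f)))
          + ∏ e ∈ cycleEdges f, pairProb w e)
      ≤ ∑ m ∈ J, (1 - r)⁻¹ * ((m + 3 : ℝ) * r ^ (m + 1) * X) := by
    refine Finset.sum_le_sum fun m _ => ?_
    refine (mul_le_mul_of_nonneg_left (sum_injective_chord_le hw hL hr hr0 hr1)
      (by positivity)).trans_eq ?_
    rw [← hX]
    field_simp
  have h4 : ∑ m ∈ J, (m + 3 : ℝ) * r ^ (m + 1) ≤ ∑' m : ℕ, (m + 3 : ℝ) * r ^ (m + 1) :=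
    (summable_mul_pow hr0 hr1).sum_le_tsum _ fun m _ => by positivity
  have h5 := abs_exp_neg_sub_exp_neg_le hS0 (cycleSum_nonneg J hx0)
  calc _ ≤ |graphPr w (NoCycle J) - Real.exp (-S)| + |Real.exp (-S) - Real.exp (-cycleSum J x)| :=
        abs_sub_le _ _ _
    _ ≤ ∑ m ∈ J, (1 - r)⁻¹ * ((m + 3 : ℝ) * r ^ (m + 1) * X)
        + ∑ m ∈ J, (m + 3 : ℝ) * r ^ (m + 1) * X :=
        add_le_add (h1.trans h3) (h5.trans h2)
    _ = (1 + (1 - r)⁻¹) * (∑ m ∈ J, (m + 3 : ℝ) * r ^ (m + 1)) * X := by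
        rw [← Finset.mul_sum, ← Finset.sum_mul]; ring
    _ ≤ _ := by
        unfold poissonConst
        gcongr

end poisson

/-! ### Expansion around the mean -/

section expansion

variable {r : ℝ}

lemma abs_pow_sub_sub_le {x y : ℝ} (hx : 0 ≤ x) (hy : 0 ≤ y) (hxr : x ≤ r) (hyr : y ≤ r)
    (j : ℕ) : |x ^ (j + 2) - y ^ (j + 2) - (j + 2) * y ^ (j + 1) * (x - y)|
      ≤ (j + 2 : ℝ) ^ 2 * r ^ j * (x - y) ^ 2 := by
  have hr0 : 0 ≤ r := hx.trans hxr
  induction j with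
  | zero =>
    have : x ^ (0 + 2) - y ^ (0 + 2) - ((0 : ℕ) + 2) * y ^ (0 + 1) * (x - y) = (x - y) ^ 2 := by
      push_cast; ring
    rw [this, abs_of_nonneg (sq_nonneg _)]
    push_cast
    nlinarith [sq_nonneg (x - y)]
  | succ j ih =>
    -- Recursion for the Taylor remainder, R_(k+1) = x R_k + k y^(k-1) (x - y)² with k = j + 2; the
    -- constants close because k² + k ≤ (k + 1)².
    have e : x ^ (j + 1 + 2) - y ^ (j + 1 + 2) - ((j + 1 : ℕ) + 2) * y ^ (j + 1 + 1) * (x - y)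
        = x * (x ^ (j + 2) - y ^ (j + 2) - (j + 2) * y ^ (j + 1) * (x - y))
          + (j + 2) * y ^ (j + 1) * (x - y) ^ 2 := by
      push_cast; ring
    rw [e]
    refine (abs_add_le _ _).trans ?_
    rw [abs_mul, abs_of_nonneg hx, abs_of_nonneg (by positivity : (0 : ℝ) ≤
      (j + 2) * y ^ (j + 1) * (x - y) ^ 2)]
    calc x * |x ^ (j + 2) - y ^ (j + 2) - (j + 2) * y ^ (j + 1) * (x - y)|
          + (j + 2) * y ^ (j + 1) * (x - y) ^ 2
        ≤ r * ((j + 2 : ℝ) ^ 2 * r ^ j * (x - y) ^ 2) + (j + 2) * r ^ (j + 1) * (x - y) ^ 2 := by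
          gcongr
      _ = ((j + 2 : ℝ) ^ 2 + (j + 2)) * (r ^ (j + 1) * (x - y) ^ 2) := by ring
      _ ≤ ((j + 1 : ℕ) + 2 : ℝ) ^ 2 * (r ^ (j + 1) * (x - y) ^ 2) := by
          refine mul_le_mul_of_nonneg_right ?_ (by positivity)
          push_cast
          nlinarith [Nat.cast_nonneg (α := ℝ) j]
      _ = _ := by ring

/-- The derivative of `cycleSum J`. -/
noncomputable def cycleSumDeriv (J : Finset ℕ) (x : ℝ) : ℝ :=
  ∑ m ∈ J, 1 / 2 * x ^ (m + 2)

/-- A bound for the derivatives of `cycleSum J` on `[0, r]`. -/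
noncomputable def cycleSumConst (r : ℝ) : ℝ := ∑' m : ℕ, (m + 3 : ℝ) * r ^ (m + 1)

lemma cycleSumConst_nonneg (hr0 : 0 ≤ r) : 0 ≤ cycleSumConst r :=
  tsum_nonneg fun m => by positivity

lemma cycleSumDeriv_mem (hr1 : r < 1) (J : Finset ℕ) {y : ℝ} (hy : 0 ≤ y) (hyr : y ≤ r) :
    0 ≤ cycleSumDeriv J y ∧ cycleSumDeriv J y ≤ cycleSumConst r := by
  have hr0 : 0 ≤ r := hy.trans hyr
  refine ⟨Finset.sum_nonneg fun m _ => by positivity, ?_⟩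
  refine le_trans (Finset.sum_le_sum fun m _ => ?_)
    ((summable_mul_pow hr0 hr1).sum_le_tsum J fun m _ => by positivity)
  calc 1 / 2 * y ^ (m + 2) = (1 / 2 * y) * y ^ (m + 1) := by ring
    _ ≤ (m + 3) * r ^ (m + 1) := by
      have : 1 / 2 * y ≤ m + 3 := by linarith [Nat.cast_nonneg (α := ℝ) m]
      gcongr

lemma abs_cycleSum_sub_sub_le (hr1 : r < 1) (J : Finset ℕ) {x y : ℝ} (hx : 0 ≤ x) (hy : 0 ≤ y)
    (hxr : x ≤ r) (hyr : y ≤ r) :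
    |cycleSum J x - cycleSum J y - cycleSumDeriv J y * (x - y)|
      ≤ cycleSumConst r * (x - y) ^ 2 := by
  have hr0 : 0 ≤ r := hy.trans hyr
  have h4 : ∑ m ∈ J, (m + 3 : ℝ) * r ^ (m + 1) ≤ cycleSumConst r :=
    (summable_mul_pow hr0 hr1).sum_le_tsum _ fun m _ => by positivity
  refine le_trans ?_ (mul_le_mul_of_nonneg_right h4 (sq_nonneg _))
  unfold cycleSum cycleSumDeriv
  rw [← Finset.sum_sub_distrib, Finset.sum_mul, ← Finset.sum_sub_distrib, Finset.sum_mul]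
  refine (Finset.abs_sum_le_sum_abs _ _).trans (Finset.sum_le_sum fun m _ => ?_)
  have h := abs_pow_sub_sub_le hx hy hxr hyr (m + 1)
  push_cast at h
  have e : 1 / (2 * (m + 3 : ℝ)) * x ^ (m + 3) - 1 / (2 * (m + 3 : ℝ)) * y ^ (m + 3)
      - 1 / 2 * y ^ (m + 2) * (x - y) = 1 / (2 * (m + 3 : ℝ)) *
        (x ^ (m + 1 + 2) - y ^ (m + 1 + 2) - (m + 1 + 2) * y ^ (m + 1 + 1) * (x - y)) := by
    field_simp
    ring
  rw [e, abs_mul, abs_of_nonneg (by positivity)]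
  refine (mul_le_mul_of_nonneg_left h (by positivity)).trans ?_
  have e2 : 1 / (2 * (m + 3 : ℝ)) * ((m + 1 + 2 : ℝ) ^ 2 * r ^ (m + 1) * (x - y) ^ 2)
      = 1 / 2 * ((m + 3 : ℝ) * r ^ (m + 1) * (x - y) ^ 2) := by
    field_simp
    ring
  rw [e2]
  have : 0 ≤ (m + 3 : ℝ) * r ^ (m + 1) * (x - y) ^ 2 := by positivity
  linarith

/-- The lower bound is convexity. For the upper bound, the tangent at `u` leaves (e^(-v) - e^(-u))
(u - v), and the exponential is 1-Lipschitz here. -/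
lemma abs_exp_neg_sub_add_le {u v : ℝ} (hu : 0 ≤ u) (hv : 0 ≤ v) :
    |Real.exp (-u) - Real.exp (-v) + Real.exp (-v) * (u - v)| ≤ (u - v) ^ 2 := by
  have h1 : Real.exp (-v) * (1 - (u - v)) ≤ Real.exp (-u) := by
    have : Real.exp (-u) = Real.exp (-v) * Real.exp (-(u - v)) := by
      rw [← Real.exp_add]; congr 1; ring
    rw [this]
    gcongr
    linarith [Real.add_one_le_exp (-(u - v))]
  have h2 : Real.exp (-u) * (1 + (u - v)) ≤ Real.exp (-v) := by
    have : Real.exp (-v) = Real.exp (-u) * Real.exp (u - v) := by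
      rw [← Real.exp_add]; congr 1; ring
    rw [this]
    gcongr
    linarith [Real.add_one_le_exp (u - v)]
  have h3 := abs_exp_neg_sub_exp_neg_le hv hu
  have h4 : (Real.exp (-v) - Real.exp (-u)) * (u - v) ≤ (u - v) ^ 2 := by
    refine (le_abs_self _).trans ?_
    rw [abs_mul, ← sq_abs, sq]
    rw [abs_sub_comm v u] at h3
    gcongr
  rw [abs_le]
  constructor <;> nlinarith

lemma abs_exp_neg_cycleSum_sub_le (hr1 : r < 1) (J : Finset ℕ) {x y : ℝ} (hx : 0 ≤ x)
    (hy : 0 ≤ y) (hxr : x ≤ r) (hyr : y ≤ r) :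
    |Real.exp (-cycleSum J x) - Real.exp (-cycleSum J y)
      + Real.exp (-cycleSum J y) * cycleSumDeriv J y * (x - y)|
      ≤ (4 * cycleSumConst r ^ 2 + cycleSumConst r) * (x - y) ^ 2 := by
  have hr0 : 0 ≤ r := hy.trans hyr
  have h1 := abs_exp_neg_sub_add_le (cycleSum_nonneg J hx) (cycleSum_nonneg J hy)
  have h2 := abs_cycleSum_sub_sub_le hr1 J hx hy hxr hyr
  have h3 := cycleSumDeriv_mem hr1 J hy hyr
  have hK := cycleSumConst_nonneg hr0
  have hE : Real.exp (-cycleSum J y) ≤ 1 :=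
    Real.exp_le_one_iff.2 (by linarith [cycleSum_nonneg J hy])
  have hE0 := Real.exp_nonneg (-cycleSum J y)
  set u := cycleSum J x
  set v := cycleSum J y
  set d := cycleSumDeriv J y
  set K := cycleSumConst r
  -- Both points lie in [0, r] with r < 1, so the quadratic remainder is also at most linear; this
  -- gives the Lipschitz constant 2K.
  have hd : |x - y| ≤ 1 := by rw [abs_le]; constructor <;> linarith
  have h5 : |u - v| ≤ 2 * K * |x - y| := by
    have e : u - v = (u - v - d * (x - y)) + d * (x - y) := by ring
    rw [e]
    refine (abs_add_le _ _).trans ?_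
    rw [abs_mul d, abs_of_nonneg h3.1]
    have : K * (x - y) ^ 2 ≤ K * |x - y| := by
      rw [← sq_abs]
      refine mul_le_mul_of_nonneg_left ?_ hK
      nlinarith [abs_nonneg (x - y)]
    have := mul_le_mul_of_nonneg_right h3.2 (abs_nonneg (x - y))
    linarith
  have h6 : (u - v) ^ 2 ≤ 4 * K ^ 2 * (x - y) ^ 2 := by
    rw [← sq_abs (u - v), ← sq_abs (x - y)]
    calc |u - v| ^ 2 ≤ (2 * K * |x - y|) ^ 2 := by gcongr
      _ = _ := by ring
  have e : Real.exp (-u) - Real.exp (-v) + Real.exp (-v) * d * (x - y)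
      = (Real.exp (-u) - Real.exp (-v) + Real.exp (-v) * (u - v))
        - Real.exp (-v) * (u - v - d * (x - y)) := by ring
  rw [e]
  refine (abs_sub _ _).trans ?_
  rw [abs_mul (Real.exp (-v)), abs_of_nonneg hE0]
  have h7 := mul_le_mul hE h2 (abs_nonneg _) zero_le_one
  linarith

/-- Typical weights. Three errors add up: the Poisson approximation, the Taylor remainder, and the
replacement of the denominator L by nμ, which makes the first-order term truly linear in B and L. -/
lemma abs_sub_le_of_le_sum {p q ψ c a μ ρ n L B M T Q K₂ K : ℝ} (hn : 0 < n) (ha : 0 < a)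
    (hμ : 0 < μ) (hQ : 0 ≤ Q) (hK₂ : 0 ≤ K₂) (hM : 0 ≤ M) (hc : 0 ≤ c) (hcK : c ≤ K)
    (hLa : n * a ≤ L) (h1 : |p - q| ≤ Q * (M / L ^ 2))
    (h2 : |q - ψ + c * (B / L - ρ)| ≤ K₂ * (B / L - ρ) ^ 2)
    (hY : (B - ρ * L) ^ 2 ≤ 2 * T) (hLT : (L - n * μ) ^ 2 ≤ T) :
    |p - ψ - -c / μ * ((B - ρ * L) / n)|
      ≤ (Q / a ^ 2 + K₂ * (2 / a ^ 2) + K * (2 / (a * μ))) * ((T + M) / n ^ 2) := by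
  have hL : 0 < L := (by positivity : 0 < n * a).trans_le hLa
  have hT0 : 0 ≤ T := (sq_nonneg _).trans hLT
  have hK : 0 ≤ K := hc.trans hcK
  have hxρ : B / L - ρ = (B - ρ * L) / L := by field_simp
  have b1 : Q * (M / L ^ 2) ≤ Q / a ^ 2 * ((T + M) / n ^ 2) := by
    calc Q * (M / L ^ 2) ≤ Q * ((T + M) / (n * a) ^ 2) := by
          gcongr; linarith
      _ = _ := by field_simp
  have b2 : K₂ * (B / L - ρ) ^ 2 ≤ K₂ * (2 / a ^ 2) * ((T + M) / n ^ 2) := by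
    calc K₂ * (B / L - ρ) ^ 2 ≤ K₂ * ((2 * (T + M)) / (n * a) ^ 2) := by
          rw [hxρ, div_pow]
          gcongr
          linarith
      _ = _ := by field_simp
  have b3 : |c * ((B - ρ * L) / L - (B - ρ * L) / (n * μ))| ≤
      K * (2 / (a * μ)) * ((T + M) / n ^ 2) := by
    have e : (B - ρ * L) / L - (B - ρ * L) / (n * μ)
        = (B - ρ * L) * (n * μ - L) / (L * (n * μ)) := by field_simp
    rw [e, abs_mul, abs_of_nonneg hc, abs_div, abs_of_pos (by positivity : 0 < L * (n * μ))]
    have h3 : |(B - ρ * L) * (n * μ - L)| ≤ 2 * (T + M) := by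
      rw [abs_le]
      constructor <;> nlinarith [sq_nonneg ((B - ρ * L) + (n * μ - L)),
        sq_nonneg ((B - ρ * L) - (n * μ - L))]
    calc c * (|(B - ρ * L) * (n * μ - L)| / (L * (n * μ)))
        ≤ K * (2 * (T + M) / ((n * a) * (n * μ))) := by gcongr
      _ = _ := by field_simp
  have e : p - ψ - -c / μ * ((B - ρ * L) / n) =
      (p - q) + (q - ψ + c * (B / L - ρ))
      - c * ((B - ρ * L) / L - (B - ρ * L) / (n * μ)) := by
    rw [hxρ]; field_simp; ring
  rw [e]
  refine (abs_sub _ _).trans ((add_le_add_left (abs_add_le _ _) _).trans ?_)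
  linarith

/-- Atypical weights. A deviation of at least nδ makes T/n² at least δ², so the trivial bound 1 is
affordable, as in Chebyshev's inequality. -/
lemma abs_sub_le_of_le_deviation {p ψ c μ n δ Y M T K : ℝ} (hn : 0 < n) (hδ : 0 < δ)
    (hμ : 0 < μ) (hM : 0 ≤ M) (hc : 0 ≤ c) (hcK : c ≤ K) (h1 : |p - ψ| ≤ 1)
    (hY : Y ^ 2 ≤ 2 * T) (hT : (n * δ) ^ 2 ≤ T) :
    |p - ψ - -c / μ * (Y / n)|
      ≤ (1 / δ ^ 2 + K * (2 / (δ * μ))) * ((T + M) / n ^ 2) := by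
  have hT0 : 0 ≤ T := (sq_nonneg _).trans hT
  have hK : 0 ≤ K := hc.trans hcK
  have b1 : |p - ψ| ≤ 1 / δ ^ 2 * ((T + M) / n ^ 2) := by
    refine h1.trans ?_
    rw [div_mul_div_comm, one_mul, le_div_iff₀ (by positivity)]
    nlinarith
  have b2 : |-c / μ * (Y / n)| ≤ K * (2 / (δ * μ)) * ((T + M) / n ^ 2) := by
    rw [abs_mul, abs_div, abs_neg, abs_of_nonneg hc, abs_of_pos hμ, abs_div, abs_of_pos hn]
    have h1 : |Y| * (n * δ) ≤ 2 * (T + M) := by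
      nlinarith [sq_nonneg (|Y| - n * δ), sq_abs Y]
    calc c / μ * (|Y| / n) ≤ K / μ * ((2 * (T + M) / (n * δ)) / n) := by
          gcongr
          rwa [le_div_iff₀ (by positivity)]
      _ = _ := by field_simp
  refine (abs_sub _ _).trans ?_
  linarith

/-- Second order expansion of the conditional probability that there is no cycle of certain
lengths. -/
theorem exists_abs_graphPr_noCycle_sub_le {b₀ μ : ℝ} (hb : 0 ≤ b₀) (hbμ : b₀ < μ) :
    ∃ C, 0 ≤ C ∧ ∀ J : Finset ℕ, ∃ c : ℝ, ∀ n : ℕ, 0 < n → ∀ w : Fin n → ℝ, (∀ i, 0 < w i) →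
      |graphPr w (NoCycle J) - Real.exp (-cycleSum J (b₀ / μ))
          - c * (((∑ i, w i ^ 2) - b₀ / μ * ∑ i, w i) / n)|
        ≤ C * ((((∑ i, w i ^ 2) - n * b₀) ^ 2 + ((∑ i, w i) - n * μ) ^ 2 + ∑ i, w i ^ 4)
          / (n : ℝ) ^ 2) := by
  have hμ : 0 < μ := hb.trans_lt hbμ
  -- The points b < a cut [b₀, μ] into thirds of length δ. If L ≥ na and B ≤ nb, then B/L ≤ b/a < 1;
  -- otherwise L or B deviates by at least nδ.
  obtain ⟨a, ha⟩ : ∃ a, a = (2 * μ + b₀) / 3 := ⟨_, rfl⟩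
  obtain ⟨b, hb'⟩ : ∃ b, b = (μ + 2 * b₀) / 3 := ⟨_, rfl⟩
  obtain ⟨δ, hδ⟩ : ∃ δ, δ = (μ - b₀) / 3 := ⟨_, rfl⟩
  have hδ0 : 0 < δ := by linarith
  have ha0 : 0 < a := by linarith
  have hb0 : 0 < b := by linarith
  have hba : b < a := by linarith
  obtain ⟨ρ, hρ⟩ : ∃ ρ, ρ = b₀ / μ := ⟨_, rfl⟩
  rw [← hρ]
  have hρ0 : 0 ≤ ρ := by rw [hρ]; positivity
  have hρ1 : ρ ≤ 1 := by rw [hρ]; exact (div_le_one hμ).2 hbμ.le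
  have hρμ : ρ * μ = b₀ := by rw [hρ]; field_simp
  obtain ⟨r, hr⟩ : ∃ r, r = b / a := ⟨_, rfl⟩
  have hr0 : 0 ≤ r := by rw [hr]; positivity
  have hr1 : r < 1 := by rw [hr]; exact (div_lt_one ha0).2 hba
  have hra : r * a = b := by rw [hr]; field_simp
  have hρr : ρ ≤ r := by
    rw [hρ, hr]
    gcongr <;> linarith
  have hK0 : 0 ≤ cycleSumConst r := cycleSumConst_nonneg hr0
  have hQ0 : 0 ≤ poissonConst r := poissonConst_nonneg hr0 hr1
  obtain ⟨C₁, hC₁⟩ : ∃ C₁, C₁ = poissonConst r / a ^ 2 +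
    (4 * cycleSumConst r ^ 2 + cycleSumConst r) * (2 / a ^ 2) +
    cycleSumConst r * (2 / (a * μ)) := ⟨_, rfl⟩
  obtain ⟨C₂, hC₂⟩ : ∃ C₂, C₂ = 1 / δ ^ 2 + cycleSumConst r * (2 / (δ * μ)) := ⟨_, rfl⟩
  have hC₁0 : 0 ≤ C₁ := by rw [hC₁]; positivity
  have hC₂0 : 0 ≤ C₂ := by rw [hC₂]; positivity
  refine ⟨C₁ + C₂, by positivity, fun J => ?_⟩
  have hψ1 : Real.exp (-cycleSum J ρ) ≤ 1 :=
    Real.exp_le_one_iff.2 (by linarith [cycleSum_nonneg J hρ0])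
  have hψ0 : 0 ≤ Real.exp (-cycleSum J ρ) := Real.exp_nonneg _
  have hd' := cycleSumDeriv_mem hr1 J hρ0 hρr
  have hc : Real.exp (-cycleSum J ρ) * cycleSumDeriv J ρ ≤ cycleSumConst r :=
    (mul_le_of_le_one_left hd'.1 hψ1).trans hd'.2
  have hc0 : 0 ≤ Real.exp (-cycleSum J ρ) * cycleSumDeriv J ρ := mul_nonneg hψ0 hd'.1
  -- The derivative of exp(-cycleSum J) at ρ, divided by μ. It does not depend on the weights, so
  -- the linear term can later be integrated away.
  refine ⟨-(Real.exp (-cycleSum J ρ) * cycleSumDeriv J ρ) / μ, fun n hn w hw => ?_⟩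
  have hn' : (0 : ℝ) < n := by exact_mod_cast hn
  have hL : 0 < ∑ l, w l := Finset.sum_pos (fun l _ => hw l) ⟨⟨0, hn⟩, Finset.mem_univ _⟩
  have hp0 := graphPr_nonneg hw (NoCycle J)
  have hp1 := graphPr_le_one hw (NoCycle J)
  have hmain := fun h => abs_graphPr_noCycle_sub_exp_le hw hL h hr0 hr1 J
  have hM : 0 ≤ ∑ i, w i ^ 4 := Finset.sum_nonneg fun v _ => by positivity
  have hB : 0 ≤ ∑ i, w i ^ 2 := Finset.sum_nonneg fun v _ => by positivity
  generalize ∑ i, w i = L at *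
  generalize ∑ i, w i ^ 2 = B at *
  generalize ∑ i, w i ^ 4 = M at *
  generalize graphPr w (NoCycle J) = p at *
  obtain ⟨T, hT⟩ : ∃ T, T = (B - n * b₀) ^ 2 + (L - n * μ) ^ 2 := ⟨_, rfl⟩
  have hT0 : 0 ≤ T := by rw [hT]; positivity
  rw [← hT]
  have hX : 0 ≤ (T + M) / (n : ℝ) ^ 2 := by positivity
  have hY : (B - ρ * L) ^ 2 ≤ 2 * T := by
    -- Since ρμ = b₀, this quantity is already centred.
    have e : B - ρ * L = (B - n * b₀) - ρ * (L - n * μ) := by rw [← hρμ]; ring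
    have h1 : (ρ * (L - n * μ)) ^ 2 ≤ (L - n * μ) ^ 2 := by
      rw [mul_pow]
      exact mul_le_of_le_one_left (sq_nonneg _) (pow_le_one₀ hρ0 hρ1)
    rw [e, hT]
    linarith [sq_nonneg ((B - n * b₀) + ρ * (L - n * μ)),
      add_sq (B - n * b₀) (ρ * (L - n * μ)), sub_sq (B - n * b₀) (ρ * (L - n * μ))]
  by_cases hgood : n * a ≤ L ∧ B ≤ n * b
  · obtain ⟨hLa, hBb⟩ := hgood
    have hBL : B ≤ r * L := by
      calc B ≤ n * b := hBb
        _ = r * (n * a) := by rw [← hra]; ring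
        _ ≤ r * L := by gcongr
    have h2 := abs_exp_neg_cycleSum_sub_le hr1 J (by positivity : 0 ≤ B / L) hρ0
      (by rwa [div_le_iff₀ hL]) hρr
    have := abs_sub_le_of_le_sum hn' ha0 hμ hQ0 (by positivity) hM hc0 hc hLa (hmain hBL) h2 hY
      (hT ▸ le_add_of_nonneg_left (sq_nonneg _))
    rw [← hC₁] at this
    exact this.trans (mul_le_mul_of_nonneg_right (by linarith) hX)
  · have hTδ : (n * δ) ^ 2 ≤ T := by
      rw [not_and_or, not_le, not_le] at hgood
      rcases hgood with h | h
      · have : n * δ ≤ n * μ - L := by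
          have : n * δ = n * μ - n * a := by rw [hδ, ha]; ring
          linarith
        have : (n * δ) ^ 2 ≤ (n * μ - L) ^ 2 := by gcongr
        linarith [sub_sq_comm (n * μ) L, sq_nonneg (B - n * b₀)]
      · have : n * δ ≤ B - n * b₀ := by
          have : n * δ = n * b - n * b₀ := by rw [hδ, hb']; ring
          linarith
        have : (n * δ) ^ 2 ≤ (B - n * b₀) ^ 2 := by gcongr
        linarith [sq_nonneg (L - n * μ)]
    have := abs_sub_le_of_le_deviation hn' hδ0 hμ hM hc0 hc
      (abs_le.2 ⟨by linarith, by linarith⟩ : |p - Real.exp (-cycleSum J ρ)| ≤ 1) hY hTδ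
    rw [← hC₂] at this
    exact this.trans (mul_le_mul_of_nonneg_right (by linarith) hX)

end expansion

/-! ### Averaging over the weights -/

section average

variable {Ω₀ Ω : Type*} [MeasurableSpace Ω₀] [MeasurableSpace Ω] {P₀ : Measure Ω₀} {W : Ω₀ → ℝ}
  {n : ℕ} {P : Measure Ω} {V : Fin n → Ω → ℝ} {G : Ω → SimpleGraph (Fin n)}

namespace IsGeneralisedRandomGraph

lemma ae_pos (h : IsGeneralisedRandomGraph P₀ W P V G) (hWpos : ∀ᵐ ω ∂P₀, 0 < W ω) :
    ∀ᵐ ω ∂P, ∀ i, 0 < V i ω :=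
  ae_all_iff.2 fun i => (h.identDistrib_weight i).symm.ae_snd measurableSet_Ioi hWpos

lemma measurable_weights (h : IsGeneralisedRandomGraph P₀ W P V G) :
    Measurable fun ω i => V i ω :=
  measurable_pi_lambda _ h.measurable_weight

lemma measurableSet_setOf (h : IsGeneralisedRandomGraph P₀ W P V G)
    (s : SimpleGraph (Fin n) → Prop) : MeasurableSet {ω | s (G ω)} := by
  have : {ω | s (G ω)} = ⋃ g ∈ {g | s g}, {ω | G ω = g} := by ext ω; simp
  rw [this]
  exact MeasurableSet.biUnion (Set.to_countable _) fun g _ => h.measurableSet_graph g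

variable [IsProbabilityMeasure P]

lemma integrable_graphProb (h : IsGeneralisedRandomGraph P₀ W P V G)
    (hWpos : ∀ᵐ ω ∂P₀, 0 < W ω) (g : SimpleGraph (Fin n)) :
    Integrable (fun ω => graphProb (fun i => V i ω) g) P := by
  refine Integrable.of_bound
    ((measurable_graphProb g).comp h.measurable_weights).aestronglyMeasurable 1 ?_
  filter_upwards [h.ae_pos hWpos] with ω hω
  have := graphProb_mem_Icc _ hω g
  rw [Real.norm_eq_abs, abs_of_nonneg this.1]
  exact this.2

/-- The tower property: integrate the conditional probability given the weights. -/
lemma measureReal_eq (h : IsGeneralisedRandomGraph P₀ W P V G) (g : SimpleGraph (Fin n)) :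
    P.real {ω | G ω = g} = ∫ ω, graphProb (fun i => V i ω) g ∂P := by
  rw [← integral_congr_ae (h.condProb_graph g), integral_condExp h.measurable_weights.comap_le,
    integral_indicator (h.measurableSet_graph g)]
  simp

lemma integrable_graphPr (h : IsGeneralisedRandomGraph P₀ W P V G)
    (hWpos : ∀ᵐ ω ∂P₀, 0 < W ω) (s : SimpleGraph (Fin n) → Prop) :
    Integrable (fun ω => graphPr (fun i => V i ω) s) P :=
  integrable_finsetSum _ fun g _ => h.integrable_graphProb hWpos g

lemma measureReal_setOf (h : IsGeneralisedRandomGraph P₀ W P V G)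
    (hWpos : ∀ᵐ ω ∂P₀, 0 < W ω) (s : SimpleGraph (Fin n) → Prop) :
    P.real {ω | s (G ω)} = ∫ ω, graphPr (fun i => V i ω) s ∂P := by
  classical
  unfold graphPr
  rw [integral_finsetSum _ fun g _ => h.integrable_graphProb hWpos g]
  simp only [← h.measureReal_eq]
  rw [← measureReal_biUnion_finset]
  · congr 1
    ext ω
    simp
  · intro g _ g' _ hne
    rw [Function.onFun, Set.disjoint_left]
    rintro ω rfl h'
    exact hne h'
  · exact fun g _ => h.measurableSet_graph g

/-- Mean square deviation of the sum of a power of the weights. -/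
lemma integral_sum_pow_sub_sq (h : IsGeneralisedRandomGraph P₀ W P V G) (k : ℕ)
    (hk : MemLp (fun ω => W ω ^ k) 2 P₀) :
    MemLp (fun ω => ∑ i, V i ω ^ k) 2 P ∧
    ∫ ω, (∑ i, V i ω ^ k) ∂P = n * ∫ ω, W ω ^ k ∂P₀ ∧
    ∫ ω, ((∑ i, V i ω ^ k) - n * ∫ ω, W ω ^ k ∂P₀) ^ 2 ∂P
      = n * variance (fun ω => W ω ^ k) P₀ := by
  have hid : ∀ i, IdentDistrib (fun ω => V i ω ^ k) (fun ω => W ω ^ k) P P₀ := fun i =>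
    (h.identDistrib_weight i).pow
  have hL : ∀ i, MemLp (fun ω => V i ω ^ k) 2 P := fun i => (hid i).memLp_iff.2 hk
  have hsum : MemLp (fun ω => ∑ i, V i ω ^ k) 2 P := memLp_finsetSum _ fun i _ => hL i
  have hint : ∫ ω, (∑ i, V i ω ^ k) ∂P = n * ∫ ω, W ω ^ k ∂P₀ := by
    rw [integral_finsetSum _ fun i _ => (hL i).integrable one_le_two]
    simp [(hid _).integral_eq]
  refine ⟨hsum, hint, ?_⟩
  have hind : Set.Pairwise ((Finset.univ : Finset (Fin n)) : Set (Fin n))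
      fun i j => (fun ω => V i ω ^ k) ⟂ᵢ[P] (fun ω => V j ω ^ k) := fun i _ j _ hij =>
    (h.iIndepFun_weight.indepFun hij).comp (measurable_id.pow_const k) (measurable_id.pow_const k)
  have hvar := IndepFun.variance_sum (fun i _ => hL i) hind
  have e : (∑ i, fun ω => V i ω ^ k) = fun ω => ∑ i, V i ω ^ k := by
    ext ω; simp
  rw [e, variance_eq_integral hsum.aemeasurable, hint] at hvar
  rw [hvar]
  simp [(hid _).variance_eq]

end IsGeneralisedRandomGraph

/-- The probability that the generalised random graph has no cycle of certain lengths. -/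
theorem exists_abs_measureReal_noCycle_sub_le [IsProbabilityMeasure P₀]
    (hWm : AEMeasurable W P₀) (hWpos : ∀ᵐ ω ∂P₀, 0 < W ω)
    (hW4 : Integrable (fun ω => W ω ^ 4) P₀)
    (hsub : ∫ ω, W ω ^ 2 ∂P₀ < ∫ ω, W ω ∂P₀) :
    ∃ C : ℝ, 0 ≤ C ∧ ∀ (J : Finset ℕ) (n : ℕ), 0 < n →
      ∀ (Ω : Type*) [MeasurableSpace Ω] (P : Measure Ω) [IsProbabilityMeasure P]
        (V : Fin n → Ω → ℝ) (G : Ω → SimpleGraph (Fin n)),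
        IsGeneralisedRandomGraph P₀ W P V G →
        |P.real {ω | NoCycle J (G ω)}
          - Real.exp (-cycleSum J ((∫ ω, W ω ^ 2 ∂P₀) / ∫ ω, W ω ∂P₀))| ≤ C / n := by
  have h2 : MemLp (fun ω => W ω ^ 2) 2 P₀ := by
    rw [memLp_two_iff_integrable_sq (hWm.pow_const 2).aestronglyMeasurable]
    simpa only [← pow_mul] using hW4
  have h1 : MemLp (fun ω => W ω ^ 1) 2 P₀ := by
    rw [memLp_two_iff_integrable_sq (hWm.pow_const 1).aestronglyMeasurable]
    simpa only [pow_one] using h2.integrable one_le_two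
  obtain ⟨C, hC, H⟩ := exists_abs_graphPr_noCycle_sub_le
    (integral_nonneg fun ω => sq_nonneg (W ω)) hsub
  refine ⟨C * (variance (fun ω => W ω ^ 2) P₀ + variance (fun ω => W ω ^ 1) P₀ +
    ∫ ω, W ω ^ 4 ∂P₀), mul_nonneg hC (add_nonneg (add_nonneg (variance_nonneg _ _)
      (variance_nonneg _ _)) (integral_nonneg fun ω => by positivity)), ?_⟩
  intro J n hn Ω _ P _ V G hG
  obtain ⟨c, hc⟩ := H J
  have hn' : (0 : ℝ) < n := by exact_mod_cast hn
  have hμ : 0 < ∫ ω, W ω ∂P₀ := (integral_nonneg fun ω => sq_nonneg (W ω)).trans_lt hsub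
  obtain ⟨L2, I2, S2⟩ := hG.integral_sum_pow_sub_sq 2 h2
  obtain ⟨L1, I1, S1⟩ := hG.integral_sum_pow_sub_sq 1 h1
  have hV4 : ∀ i, Integrable (fun ω => V i ω ^ 4) P := fun i =>
    ((hG.identDistrib_weight i).pow (n := 4)).integrable_iff.2 hW4
  have L4 : Integrable (fun ω => ∑ i, V i ω ^ 4) P := integrable_finsetSum _ fun i _ => hV4 i
  have I4 : ∫ ω, (∑ i, V i ω ^ 4) ∂P = n * ∫ ω, W ω ^ 4 ∂P₀ := by
    rw [integral_finsetSum _ fun i _ => hV4 i]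
    have : ∀ i, ∫ ω, V i ω ^ 4 ∂P = ∫ ω, W ω ^ 4 ∂P₀ := fun i =>
      ((hG.identDistrib_weight i).pow (n := 4)).integral_eq
    simp [this]
  simp only [pow_one] at L1 I1 S1
  rw [hG.measureReal_setOf hWpos]
  set b₀ := ∫ ω, W ω ^ 2 ∂P₀
  set μ := ∫ ω, W ω ∂P₀
  have iP := hG.integrable_graphPr hWpos (NoCycle J)
  have iY : Integrable (fun ω => c * (((∑ i, V i ω ^ 2) - b₀ / μ * ∑ i, V i ω) / n)) P :=
    (((L2.integrable one_le_two).sub ((L1.integrable one_le_two).const_mul _)).div_const _).const_mul _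
  -- The cancellation n b₀ - (b₀/μ) n μ = 0, which improves the rate from n^(-1/2) to 1/n.
  have zY : ∫ ω, c * (((∑ i, V i ω ^ 2) - b₀ / μ * ∑ i, V i ω) / n) ∂P = 0 := by
    rw [integral_const_mul, integral_div, integral_sub (L2.integrable one_le_two)
      ((L1.integrable one_le_two).const_mul _), integral_const_mul, I1, I2]
    field_simp
    ring
  have i2 : Integrable (fun ω => ((∑ i, V i ω ^ 2) - n * b₀) ^ 2) P :=
    (L2.sub (memLp_const _)).integrable_sq
  have i1 : Integrable (fun ω => ((∑ i, V i ω) - n * μ) ^ 2) P :=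
    (L1.sub (memLp_const _)).integrable_sq
  have iPc : Integrable (fun ω => graphPr (fun i => V i ω) (NoCycle J)
      - Real.exp (-cycleSum J (b₀ / μ))) P := iP.sub (integrable_const _)
  have i12 : Integrable (fun ω => ((∑ i, V i ω ^ 2) - n * b₀) ^ 2 +
      ((∑ i, V i ω) - n * μ) ^ 2) P := i2.add i1
  have i124 : Integrable (fun ω => ((∑ i, V i ω ^ 2) - n * b₀) ^ 2 +
      ((∑ i, V i ω) - n * μ) ^ 2 + ∑ i, V i ω ^ 4) P := i12.add L4
  have e : (∫ ω, graphPr (fun i => V i ω) (NoCycle J) ∂P) - Real.exp (-cycleSum J (b₀ / μ))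
      = ∫ ω, (graphPr (fun i => V i ω) (NoCycle J) - Real.exp (-cycleSum J (b₀ / μ))
          - c * (((∑ i, V i ω ^ 2) - b₀ / μ * ∑ i, V i ω) / n)) ∂P := by
    rw [integral_sub iPc iY, zY, integral_sub iP (integrable_const _)]
    simp
  have hae : ∀ᵐ ω ∂P, ‖graphPr (fun i => V i ω) (NoCycle J) - Real.exp (-cycleSum J (b₀ / μ))
          - c * (((∑ i, V i ω ^ 2) - b₀ / μ * ∑ i, V i ω) / n)‖ ≤
        C * ((((∑ i, V i ω ^ 2) - n * b₀) ^ 2 + ((∑ i, V i ω) - n * μ) ^ 2 + ∑ i, V i ω ^ 4)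
          / (n : ℝ) ^ 2) := by
    filter_upwards [hG.ae_pos hWpos] with ω hω
    exact hc n hn _ hω
  rw [e, ← Real.norm_eq_abs]
  -- What remains is n (Var W² + Var W + E[W⁴]) / n².
  refine (norm_integral_le_of_norm_le ((i124.div_const _).const_mul C) hae).trans_eq ?_
  rw [integral_const_mul, integral_div, integral_add i12 L4, integral_add i2 i1, S1, S2, I4]
  simp only [pow_one]
  field_simp

end average

/-! ### Shortest and longest cycles -/

section extremal

variable {n : ℕ}

/-- `g` has no cycle of length at least `a + 3`. -/
def NoCycleFrom (a : ℕ) (g : SimpleGraph (Fin n)) : Prop :=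
  ∀ m, a ≤ m → ¬ ∃ (v : Fin n) (c : g.Walk v v), c.IsCycle ∧ c.length = m + 3

lemma length_le_of_isCycle {g : SimpleGraph (Fin n)} {v : Fin n} {c : g.Walk v v}
    (hc : c.IsCycle) : c.length ≤ n := by
  obtain ⟨m, hm⟩ : ∃ m, c.length = m + 3 := ⟨c.length - 3, by have := hc.three_le_length; omega⟩
  obtain ⟨f, hf, -⟩ := exists_cycleEdges_iff.1 ⟨v, c, hc, hm⟩
  have := Fintype.card_le_of_injective f hf
  rw [ZMod.card, Fintype.card_fin] at this
  omega

/-- No cycle is longer than n, so finitely many lengths suffice. `N` is left free so that it can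
tend to infinity while the event stays fixed. -/
lemma noCycle_Ico_iff {a N : ℕ} (hN : n ≤ N) (g : SimpleGraph (Fin n)) :
    NoCycle (Finset.Ico a (a + N)) g ↔ NoCycleFrom a g := by
  refine ⟨fun h m hm hc => ?_, fun h m hm => h m (Finset.mem_Ico.1 hm).1⟩
  refine h m (Finset.mem_Ico.2 ⟨hm, ?_⟩) hc
  obtain ⟨v, c, hc, hl⟩ := hc
  have := length_le_of_isCycle hc
  omega

lemma noCycleFrom_zero_iff (g : SimpleGraph (Fin n)) : NoCycleFrom 0 g ↔ g.IsAcyclic := by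
  constructor
  · intro h v c hc
    exact h (c.length - 3) (Nat.zero_le _) ⟨v, c, hc, by have := hc.three_le_length; omega⟩
  · rintro h m - ⟨v, c, hc, -⟩
    exact h c hc

lemma girth_le_iff_of_lt (g : SimpleGraph (Fin n)) {t : ℕ} (ht : t < 3) :
    g.girth ≤ t ↔ NoCycleFrom 0 g := by
  rw [noCycleFrom_zero_iff, ← SimpleGraph.girth_eq_zero]
  constructor
  · intro h
    by_contra h0
    have := SimpleGraph.three_le_girth fun h => h0 (SimpleGraph.girth_eq_zero.2 h)
    omega
  · intro h; omega

/-- Acyclic graphs count because their girth is 0 by convention. The indices m < t - 2 stand for the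
lengths m + 3 ≤ t. -/
lemma girth_le_iff_of_le (g : SimpleGraph (Fin n)) {t : ℕ} (ht : 3 ≤ t) :
    g.girth ≤ t ↔ NoCycleFrom 0 g ∨ ¬ NoCycle (Finset.range (t - 2)) g := by
  by_cases hg : g.IsAcyclic
  · simp [(noCycleFrom_zero_iff g).2 hg, SimpleGraph.girth_eq_zero.2 hg]
  · simp only [noCycleFrom_zero_iff, hg, false_or]
    constructor
    · intro h hno
      obtain ⟨v, c, hc, hl⟩ := SimpleGraph.exists_girth_eq_length.2 hg
      have := hc.three_le_length
      exact hno (c.length - 3) (Finset.mem_range.2 (by omega)) ⟨v, c, hc, by omega⟩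
    · intro h
      by_contra hlt
      refine h fun m hm => ?_
      rintro ⟨v, c, hc, hl⟩
      have := SimpleGraph.girth_le_length hc
      have := Finset.mem_range.1 hm
      omega

lemma longestCycle_le_iff (g : SimpleGraph (Fin n)) (t : ℕ) :
    longestCycle g ≤ t ↔ ∀ (v : Fin n) (c : g.Walk v v), c.IsCycle → c.length ≤ t := by
  constructor
  · intro h v c hc
    have hb : BddAbove {k | ∃ (v : Fin n) (c : g.Walk v v), c.IsCycle ∧ c.length = k} :=
      ⟨n, by rintro _ ⟨v, c, hc, rfl⟩; exact length_le_of_isCycle hc⟩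
    exact (le_csSup hb ⟨v, c, hc, rfl⟩).trans h
  · intro h
    refine csSup_le' ?_
    rintro _ ⟨v, c, hc, rfl⟩
    exact h v c hc

lemma longestCycle_le_iff_of_lt (g : SimpleGraph (Fin n)) {t : ℕ} (ht : t < 3) :
    longestCycle g ≤ t ↔ NoCycleFrom 0 g := by
  rw [longestCycle_le_iff, noCycleFrom_zero_iff]
  refine forall₂_congr fun v c => ⟨fun h hc => ?_, fun h hc => absurd hc h⟩
  have := hc.three_le_length
  have := h hc
  omega

lemma longestCycle_le_iff_of_le (g : SimpleGraph (Fin n)) {t : ℕ} (ht : 3 ≤ t) :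
    longestCycle g ≤ t ↔ NoCycleFrom (t - 2) g := by
  rw [longestCycle_le_iff]
  constructor
  · rintro h m hm ⟨v, c, hc, hl⟩
    have := h v c hc
    omega
  · intro h v c hc
    by_contra hlt
    exact h (c.length - 3) (by omega) ⟨v, c, hc, by omega⟩

end extremal

/-- Both distribution functions vanish for t < 0 and otherwise depend only on the integer part of t.
-/
lemma kolmogorovDist_natCast_le {Ω Ω' : Type*} [MeasurableSpace Ω] [MeasurableSpace Ω']
    {P : Measure Ω} {X : Ω → ℕ} {Q : Measure Ω'} {Y : Ω' → ℕ} {ε : ℝ} (hε : 0 ≤ ε)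
    (h : ∀ t : ℕ, |P.real {ω | X ω ≤ t} - Q.real {ω | Y ω ≤ t}| ≤ ε) :
    kolmogorovDist P (fun ω => (X ω : ℝ)) Q (fun ω => (Y ω : ℝ)) ≤ ε := by
  refine ciSup_le fun t => ?_
  rcases lt_or_ge t 0 with ht | ht
  · have : ∀ k : ℕ, ¬ (k : ℝ) ≤ t := fun k hk => by
      have := Nat.cast_nonneg (α := ℝ) k
      linarith
    simpa [this] using hε
  · simpa only [Nat.le_floor_iff ht] using h ⌊t⌋₊

lemma one_le_log_of_three_le {n : ℕ} (hn : 3 ≤ n) : 1 ≤ Real.log n := by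
  have h3 : (3 : ℝ) ≤ n := by exact_mod_cast hn
  rw [Real.le_log_iff_exp_le (by linarith)]
  exact Real.exp_one_lt_three.le.trans h3

/-! ### Infinitely many lengths, and the theorem -/

section limit

variable {Ω₀ : Type*} [MeasurableSpace Ω₀] {P₀ : Measure Ω₀} {W : Ω₀ → ℝ}

lemma cycleSum_eq_sum_cycleRate (P₀ : Measure Ω₀) (W : Ω₀ → ℝ) (J : Finset ℕ) :
    cycleSum J ((∫ ω, W ω ^ 2 ∂P₀) / ∫ ω, W ω ∂P₀) = ∑ m ∈ J, cycleRate P₀ W (m + 3) := by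
  unfold cycleSum cycleRate
  refine Finset.sum_congr rfl fun m _ => ?_
  push_cast
  rfl

/-- For N ≥ n the event equals the one with lengths in a window of size N. Letting N → ∞ changes
only the exponent, and ε does not depend on the window. -/
lemma abs_measureReal_noCycleFrom_sub_le {Ω : Type*} [MeasurableSpace Ω] {P : Measure Ω} {n : ℕ}
    {G : Ω → SimpleGraph (Fin n)} {lam : ℕ → ℝ} (hlam : Summable lam) {ε : ℝ}
    (h : ∀ J : Finset ℕ, |P.real {ω | NoCycle J (G ω)}
      - Real.exp (-∑ m ∈ J, lam (m + 3))| ≤ ε) (a : ℕ) :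
    |P.real {ω | NoCycleFrom a (G ω)} - Real.exp (-∑' k : ℕ, lam (k + (a + 3)))| ≤ ε := by
  have hs : Summable fun k => lam (k + (a + 3)) := (summable_nat_add_iff _).2 hlam
  have ht := (((Real.continuous_exp.tendsto _).comp
    hs.hasSum.tendsto_sum_nat.neg).const_sub (P.real {ω | NoCycleFrom a (G ω)})).abs
  refine le_of_tendsto ht ?_
  filter_upwards [Filter.eventually_ge_atTop n] with N hN
  have := h (Finset.Ico a (a + N))
  simp only [noCycle_Ico_iff hN, Finset.sum_Ico_eq_sum_range, Nat.add_sub_cancel_left] at this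
  have e : ∀ k, a + k + 3 = k + (a + 3) := fun k => by omega
  simp only [e] at this
  exact this

end limit

theorem theorem2p5 {Ω₀ : Type*} [MeasurableSpace Ω₀] (P₀ : Measure Ω₀)
    [IsProbabilityMeasure P₀] (W : Ω₀ → ℝ) (hWm : AEMeasurable W P₀)
    (hWpos : ∀ᵐ ω ∂P₀, 0 < W ω)
    (hW4 : Integrable (fun ω => W ω ^ 4) P₀)
    (hsub : ∫ ω, W ω ^ 2 ∂P₀ < ∫ ω, W ω ∂P₀)
    {Ω₁ : Type*} [MeasurableSpace Ω₁] (P₁ : Measure Ω₁) [IsProbabilityMeasure P₁] (S : Ω₁ → ℕ)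
    (hS : IsShortestCycleLimit (cycleRate P₀ W) P₁ S)
    {Ω₂ : Type*} [MeasurableSpace Ω₂] (P₂ : Measure Ω₂) [IsProbabilityMeasure P₂] (L : Ω₂ → ℕ)
    (hL : IsLongestCycleLimit (cycleRate P₀ W) P₂ L) :
    (∃ C : ℝ, 0 < C ∧ ∀ n : ℕ, 3 ≤ n →
      ∀ (Ω : Type*) [MeasurableSpace Ω] (P : Measure Ω) [IsProbabilityMeasure P]
        (V : Fin n → Ω → ℝ) (G : Ω → SimpleGraph (Fin n)),
        IsGeneralisedRandomGraph P₀ W P V G →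
        kolmogorovDist P (fun ω => ((G ω).girth : ℝ)) P₁ (fun ω => (S ω : ℝ))
          ≤ C * Real.log n ^ 3 / n) ∧
    (∃ C : ℝ, 0 < C ∧ ∀ n : ℕ, 3 ≤ n →
      ∀ (Ω : Type*) [MeasurableSpace Ω] (P : Measure Ω) [IsProbabilityMeasure P]
        (V : Fin n → Ω → ℝ) (G : Ω → SimpleGraph (Fin n)),
        IsGeneralisedRandomGraph P₀ W P V G →
        kolmogorovDist P (fun ω => (longestCycle (G ω) : ℝ)) P₂ (fun ω => (L ω : ℝ))
          ≤ C * Real.log n ^ 3 / n) := by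
  have hlam := (summable_cycleRate P₀ W hsub).1
  -- The proved rate is 2C/n; log n ≥ 1 for n ≥ 3 inserts the logarithms, and the added 1 keeps the
  -- constant positive.
  have hbound : ∀ {C : ℝ}, 0 ≤ C → ∀ {n : ℕ}, 3 ≤ n →
      2 * (C / n) ≤ (2 * C + 1) * Real.log n ^ 3 / n := by
    intro C hC n hn
    have h1 : 1 ≤ Real.log n ^ 3 := one_le_pow₀ (one_le_log_of_three_le hn)
    rw [← mul_div_assoc]
    refine div_le_div_of_nonneg_right ?_ (Nat.cast_nonneg n)
    nlinarith
  constructor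
  · obtain ⟨C, hC, H⟩ := exists_abs_measureReal_noCycle_sub_le hWm hWpos hW4 hsub
    refine ⟨2 * C + 1, by positivity, fun n hn Ω _ P _ V G hG => ?_⟩
    have H := fun J => H J n (by omega) Ω P V G hG
    simp only [cycleSum_eq_sum_cycleRate] at H
    have H0 := abs_measureReal_noCycleFrom_sub_le hlam H 0
    rw [zero_add, ← hS.prob_zero] at H0
    have hCn : 0 ≤ C / n := by positivity
    refine le_trans (kolmogorovDist_natCast_le (by positivity) fun t => ?_) (hbound hC hn)
    rcases lt_or_ge t 3 with ht | ht
    · have e : {ω | S ω ≤ t} = {ω | S ω = 0} := by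
        ext ω
        have := hS.range ω
        simp only [Set.mem_ofPred_eq]
        omega
      simp only [girth_le_iff_of_lt _ ht]
      rw [e]
      linarith
    · have e : {ω | S ω ≤ t} = {ω | S ω = 0} ∪ {ω | 3 ≤ S ω ∧ S ω ≤ t} := by
        ext ω
        have := hS.range ω
        simp only [Set.mem_ofPred_eq, Set.mem_union]
        omega
      -- The event splits disjointly into having no cycle and having a cycle of length at most `t`.
      -- Two no-cycle probabilities are compared with their limits, hence the factor 2.
      have e' : {ω | (G ω).girth ≤ t} =
          {ω | NoCycleFrom 0 (G ω)} ∪ {ω | NoCycle (Finset.range (t - 2)) (G ω)}ᶜ := by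
        ext ω
        exact girth_le_iff_of_le _ ht
      have hm := hG.measurableSet_setOf (NoCycle (Finset.range (t - 2)))
      rw [e, e', measureReal_union _ hm.compl, measureReal_union, hS.prob_le t ht,
        probReal_compl_eq_one_sub hm]
      · have Ht := H (Finset.range (t - 2))
        have e3 : ∑ m ∈ Finset.range (t - 2), cycleRate P₀ W (m + 3)
            = ∑ k ∈ Finset.Icc 3 t, cycleRate P₀ W k := by
          rw [show Finset.Icc 3 t = Finset.Ico 3 (t + 1) by ext; simp,
            Finset.sum_Ico_eq_sum_range, show t + 1 - 3 = t - 2 by omega]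
          simp only [add_comm]
        rw [e3] at Ht
        rw [abs_le] at H0 Ht ⊢
        constructor <;> linarith
      · rw [Set.disjoint_left]
        rintro ω (h0 : S ω = 0) ⟨h1, -⟩
        omega
      · exact (hS.measurable measurableSet_Ici).inter (hS.measurable measurableSet_Iic)
      · rw [Set.disjoint_left]
        intro ω h0 h1
        exact h1 fun m _ => h0 m (Nat.zero_le m)
  · obtain ⟨C, hC, H⟩ := exists_abs_measureReal_noCycle_sub_le hWm hWpos hW4 hsub
    refine ⟨2 * C + 1, by positivity, fun n hn Ω _ P _ V G hG => ?_⟩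
    have H := fun J => H J n (by omega) Ω P V G hG
    simp only [cycleSum_eq_sum_cycleRate] at H
    have hCn : 0 ≤ C / n := by positivity
    refine le_trans (kolmogorovDist_natCast_le (by positivity) fun t => ?_) (hbound hC hn)
    rcases lt_or_ge t 3 with ht | ht
    · have e : {ω | L ω ≤ t} = {ω | L ω = 0} := by
        ext ω
        have := hL.range ω
        simp only [Set.mem_ofPred_eq]
        omega
      have H0 := abs_measureReal_noCycleFrom_sub_le hlam H 0
      rw [zero_add, ← hL.prob_zero] at H0
      simp only [longestCycle_le_iff_of_lt _ ht]
      rw [e]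
      linarith
    -- A longest cycle of length at most `t` means no cycle of length at least t + 1 = (t - 2) + 3,
    -- so a single comparison suffices.
    · have Ht := abs_measureReal_noCycleFrom_sub_le hlam H (t - 2)
      rw [show t - 2 + 3 = t + 1 by omega, ← hL.prob_le t ht] at Ht
      simp only [longestCycle_le_iff_of_le _ ht]
      linarith
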